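/- Let $n\ge 0$ and let $p\in\mathbb C\langle X_1,\dots,X_n\rangle$ be a noncommutative polynomial of degree $\deg p$ (with $\deg 0=0$) with $m_p$ monomials. Let $c$ be its constant term and $q=p-c$, and let $M\ge 1$. Let $s_1,\dots,s_n$ be free independent standard semicircular elements of a $W^*$-probability space $(\mathcal M,\tau)$ ($\tau$ a faithful normal tracial state). Let $(zq)^*=\sum_{k\ge1}z^kq^k$, a noncommutative formal power series in $X_1,\dots,X_n$ over $\mathbb C[z]$. A monoid homomorphism $\mu$ from the free monoid on $X_1,\dots,X_n$ to $M_N(\mathbb C[z])$, $N\ge2$, is said to represent $(zq)^*$ if for every word $F$ the coefficient of $F$ in $(zq)^*$ is $\mu(F)_{1,N}$. For such $\mu$ let $\mu_i\in M_N(\mathbb C[z]/(z^{M+1}))$ be the reduction of $\mu(X_i)$, and put $P^0=0$, $P^{k+1}=\sum_{i=1}^n\bigl(\mu_i(P^k+I)\bigr)^2$ in $M_N(\mathbb C[z]/(z^{M+1}))$. (1) For every $\mu$ representing $(zq)^*$ and every $1\le m\le M$, $\tau(q(s_1,\dots,s_n)^m)$ is the coefficient of $z^m$ in the $(1,N)$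 entry of $P^{(\deg p)M}$. Moreover $\tau(p(s_1,\dots,s_n)^M)=\sum_{k=0}^M\binom Mk c^k\,\tau(q(s_1,\dots,s_n)^{M-k})$. For (2) and (3) consider programs built from assignments, conditionals and counted loops for a machine whose memory holds arrays of natural numbers and arrays of complex numbers. One step is charged for each addition, truncated subtraction or comparison of natural numbers, each addition, subtraction or multiplication of complex numbers, each constant, memory access, array index, assignment and loop pass. The only complex constants in a program are $0$ and $1$. (2) There are one program and one constant $C$ such that for all $n$, $p$, $M\ge1$ and all $\mu$ representing $(zq)^*$, the program on input $(n,M,N,\deg p,c,\mu_1,\dots,\mu_n)$ computes $P^{(\deg p)M}$, the moments $\tau(q(s_1,\dots,s_n)^m)$ for $1\le m\le M$, and $\tau(p(s_1,\dots,s_n)^M)$. If $p$ is not constant, it takes at most $C\,(\deg p)\,n\,N^3M^3$ steps. (3) There are one program and one constant $C$ such that for all $n$, $p$ and $M\ge1$, the program on input $n$, $M$ and the list (in any order) of the monomials of $p$ with their nonzero coefficients computes: the constant term $c$; the size $N$ and the matrices $\mu_1,\dots,\mu_n$ of some $\mu$ representing $(zq)^*$, where $N\le 2m_q\deg q+2m_q$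 if $p$ is not constant; the matrix $P^{(\deg p)M}$ for this $\mu$; the moments $\tau(q(s_1,\dots,s_n)^m)$ for $1\le m\le M$; and $\tau(p(s_1,\dots,s_n)^M)$. If $p$ is not constant, it takes at most $C\,(\deg p)^4m_p^3\,n\,M^3$ steps. -/

import Mathlib

universe u

open scoped Polynomial

/-! ### W*-probability spaces, free independence, semicircular elements -/

/-- `τ` is a faithful normal tracial state on the W*-algebra `A`.  Normality is stated as
preservation of suprema of directed sets of positive elements. -/
structure IsFaithfulNormalTracialState {A : Type*} [CStarAlgebra A] [PartialOrder A]
    [StarOrderedRing A] (τ : A →ₗ[ℂ] ℂ) : Prop where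
  map_one : τ 1 = 1
  nonneg : ∀ a : A, 0 ≤ (τ (star a * a)).re ∧ (τ (star a * a)).im = 0
  faithful : ∀ a : A, τ (star a * a) = 0 → a = 0
  tracial : ∀ a b : A, τ (a * b) = τ (b * a)
  normal : ∀ (D : Set A) (a : A), D.Nonempty → DirectedOn (· ≤ ·) D → (∀ x ∈ D, 0 ≤ x) →
    IsLUB D a → IsLUB ((fun x => (τ x).re) '' D) (τ a).re

/-- Free independence of a finite family: alternating products of `τ`-centred one-variable
polynomials in the elements are `τ`-centred. -/
def FreelyIndependent {A : Type*} [Ring A] [Algebra ℂ A] (τ : A →ₗ[ℂ] ℂ) {n : ℕ}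
    (x : Fin n → A) : Prop :=
  ∀ l : List (Fin n × ℂ[X]), l ≠ [] → l.IsChain (fun a b => a.1 ≠ b.1) →
    (∀ a ∈ l, τ (Polynomial.aeval (x a.1) a.2) = 0) →
    τ (l.map fun a => Polynomial.aeval (x a.1) a.2).prod = 0

/-- A standard semicircular element: self-adjoint, with vanishing odd moments and with the Catalan
numbers as even moments. -/
def IsStandardSemicircular {A : Type*} [Ring A] [Algebra ℂ A] [Star A] (τ : A →ₗ[ℂ] ℂ)
    (s : A) : Prop :=
  IsSelfAdjoint s ∧
    ∀ m : ℕ, τ (s ^ m) =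
      if Even m then (1 / (((m / 2 : ℕ) : ℂ) + 1)) * (m.choose (m / 2) : ℂ) else 0

/-! ### Noncommutative polynomials and series -/

/-- Noncommutative polynomials in `n` variables over `R`. -/
abbrev NCPoly (R : Type*) [Semiring R] (n : ℕ) : Type _ := MonoidAlgebra R (FreeMonoid (Fin n))

namespace NCPoly

variable {n : ℕ}

/-- Substitution of elements of an algebra for the variables. -/
noncomputable def evalAt {A : Type*} [Ring A] [Algebra ℂ A] (s : Fin n → A) :
    NCPoly ℂ n →ₐ[ℂ] A :=
  MonoidAlgebra.lift ℂ A (FreeMonoid (Fin n)) (FreeMonoid.lift s)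

/-- The degree (with degree `0` for the zero polynomial). -/
def deg (p : NCPoly ℂ n) : ℕ := p.coeff.support.sup FreeMonoid.length

/-- The number of monomials that appear in a polynomial. -/
def numMonomials (p : NCPoly ℂ n) : ℕ := p.coeff.support.card

/-- The constant term. -/
def constPart (p : NCPoly ℂ n) : ℂ := p.coeff 1

/-- The polynomial without its constant term. -/
noncomputable def reducedPart (p : NCPoly ℂ n) : NCPoly ℂ n :=
  p - MonoidAlgebra.single 1 p.constPart

/-- The polynomial `z p`, with coefficients in `ℂ[z]`. -/
noncomputable def zMul (p : NCPoly ℂ n) : NCPoly ℂ[X] n :=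
  (Polynomial.X : ℂ[X]) • MonoidAlgebra.mapRingHom (FreeMonoid (Fin n)) Polynomial.C p

/-- If `a` has no constant term, then `a ^ k` only has words of length at least `k`. -/
theorem coeff_pow_eq_zero {R : Type*} [Semiring R] (a : NCPoly R n) (ha : a.coeff 1 = 0)
    (k : ℕ) (F : FreeMonoid (Fin n)) (hF : F.length < k) : (a ^ k).coeff F = 0 := by
  classical
  induction k generalizing F with
  | zero => omega
  | succ k ih =>
    by_contra hne
    rw [pow_succ, MonoidAlgebra.coeff_mul] at hne
    apply hne
    refine Finset.sum_eq_zero fun u _ => Finset.sum_eq_zero fun v _ => ?_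
    dsimp only
    split_ifs with huv
    · by_cases hv : v = 1
      · rw [hv, ha, mul_zero]
      · have hvl : v.length ≠ 0 := fun h => hv (FreeMonoid.length_eq_zero.1 h)
        have hlen : F.length = u.length + v.length := by rw [← huv]; exact FreeMonoid.length_mul u v
        rw [ih u (by omega), zero_mul]
    · rfl

/-- The pseudo-inverse `a^* = ∑_{k ≥ 1} a ^ k` of a polynomial `a` without constant term, as a
formal power series, that is, as the family of its coefficients.  The terms with `k` larger than
the length of the word do not contribute, by `coeff_pow_eq_zero`. -/
noncomputable def pseudoInverse {R : Type*} [Semiring R] (a : NCPoly R n) :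
    FreeMonoid (Fin n) → R :=
  fun F => ∑ k ∈ Finset.Icc 1 F.length, (a ^ k).coeff F

end NCPoly

/-! ### Matrix representations and the iteration -/

/-- The index of the first row of an `N × N` matrix. -/
def firstIdx {N : ℕ} (hN : 2 ≤ N) : Fin N := ⟨0, by omega⟩

/-- The index of the last column of an `N × N` matrix. -/
def lastIdx {N : ℕ} (hN : 2 ≤ N) : Fin N := ⟨N - 1, by omega⟩

/-- The monoid homomorphism `μ` represents the series with coefficients `a`: the coefficient of
every word `F` is the `(1, N)` entry of `μ F`. -/
def Represents {R : Type*} [Semiring R] {n N : ℕ} (hN : 2 ≤ N)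
    (μ : FreeMonoid (Fin n) →* Matrix (Fin N) (Fin N) R) (a : FreeMonoid (Fin n) → R) : Prop :=
  ∀ F, a F = μ F (firstIdx hN) (lastIdx hN)

/-- The iteration `P⁰ = 0`, `Pᵏ⁺¹ = ∑ᵢ (μᵢ (Pᵏ + I))²`. -/
def matrixIterate {R : Type*} [Semiring R] {n N : ℕ} (μ : Fin n → Matrix (Fin N) (Fin N) R) :
    ℕ → Matrix (Fin N) (Fin N) R
  | 0 => 0
  | k + 1 => ∑ i, (μ i * (matrixIterate μ k + 1)) ^ 2

/-- The ring `ℂ[z] / (z ^ (M + 1))`. -/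
abbrev TruncPoly (M : ℕ) : Type := AdjoinRoot (Polynomial.X ^ (M + 1) : ℂ[X])

/-- The coefficient of `z ^ m` (for `m ≤ M`) of an element of `ℂ[z] / (z ^ (M + 1))`, read off its
representative of degree at most `M`. -/
noncomputable def truncCoeff {M : ℕ} (m : ℕ) (f : TruncPoly M) : ℂ :=
  (AdjoinRoot.modByMonicHom (Polynomial.monic_X_pow (R := ℂ) (M + 1)) f).coeff m

/-- The matrices `μᵢ`: the images of the variables, reduced modulo `z ^ (M + 1)`. -/
noncomputable def truncMatrices {n N : ℕ} (M : ℕ)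
    (μ : FreeMonoid (Fin n) →* Matrix (Fin N) (Fin N) ℂ[X]) :
    Fin n → Matrix (Fin N) (Fin N) (TruncPoly M) :=
  fun i => (μ (FreeMonoid.of i)).map (AdjoinRoot.mk (Polynomial.X ^ (M + 1) : ℂ[X]))

/-! ### A machine model with a step count

Programs of an algebraic random access machine.  It has a memory of natural numbers and a memory of
ring elements ("numbers").  Each memory consists of arrays named by natural numbers, and the cells of
an array are indexed by lists of natural numbers; the cell with the empty index is a scalar
variable.  An array index in a program is a list of names of scalar variables.  Each elementary
operation on natural numbers (addition, truncated subtraction, comparison) and on numbers (addition,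
subtraction, multiplication), each constant, each memory access, each index used in an access, each
assignment, each test and each pass of a loop is one step.  The only constants for numbers are
`0` and `1`. -/

namespace Machine

/-- Expressions for natural numbers. -/
inductive NatExp : Type
  | const (k : ℕ) : NatExp
  | cell (a : ℕ) (idx : List ℕ) : NatExp
  | add (e f : NatExp) : NatExp
  | sub (e f : NatExp) : NatExp

/-- Expressions for numbers. -/
inductive NumExp : Type
  | zero : NumExp
  | one : NumExp
  | cell (a : ℕ) (idx : List ℕ) : NumExp
  | add (e f : NumExp) : NumExp
  | sub (e f : NumExp) : NumExp
  | mul (e f : NumExp) : NumExp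

/-- Programs.  `ite e f c d` runs `c` if `e ≤ f` and `d` otherwise; `loop x e c` evaluates `e` once
and runs `c` with the scalar variable `x` set to `0, 1, …, e - 1` in turn. -/
inductive Program : Type
  | skip : Program
  | setNat (a : ℕ) (idx : List ℕ) (e : NatExp) : Program
  | setNum (a : ℕ) (idx : List ℕ) (e : NumExp) : Program
  | seq (c d : Program) : Program
  | ite (e f : NatExp) (c d : Program) : Program
  | loop (x : ℕ) (e : NatExp) (c : Program) : Program

/-- The memory of the machine, for numbers in `R`. -/
structure Store (R : Type*) where
  nat : ℕ → List ℕ → ℕ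
  num : ℕ → List ℕ → R

variable {R : Type*}

/-- The index described by a list of scalar variables. -/
def Store.index (s : Store R) (idx : List ℕ) : List ℕ := idx.map fun x => s.nat x []

/-- Overwrite a cell of the memory of natural numbers. -/
def Store.setNat (s : Store R) (a : ℕ) (i : List ℕ) (v : ℕ) : Store R where
  nat := fun b j => if b = a ∧ j = i then v else s.nat b j
  num := s.num

/-- Overwrite a cell of the memory of numbers. -/
def Store.setNum (s : Store R) (a : ℕ) (i : List ℕ) (v : R) : Store R where
  nat := s.nat
  num := fun b j => if b = a ∧ j = i then v else s.num b j

/-- The value of an expression. -/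
def NatExp.eval (s : Store R) : NatExp → ℕ
  | const k => k
  | cell a idx => s.nat a (s.index idx)
  | add e f => e.eval s + f.eval s
  | sub e f => e.eval s - f.eval s

/-- The number of steps taken by the evaluation of an expression. -/
def NatExp.cost : NatExp → ℕ
  | const _ => 1
  | cell _ idx => 1 + idx.length
  | add e f => e.cost + f.cost + 1
  | sub e f => e.cost + f.cost + 1

/-- The value of an expression. -/
def NumExp.eval [Ring R] (s : Store R) : NumExp → R
  | zero => 0
  | one => 1
  | cell a idx => s.num a (s.index idx)
  | add e f => e.eval s + f.eval s
  | sub e f => e.eval s - f.eval s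
  | mul e f => e.eval s * f.eval s

/-- The number of steps taken by the evaluation of an expression. -/
def NumExp.cost : NumExp → ℕ
  | zero => 1
  | one => 1
  | cell _ idx => 1 + idx.length
  | add e f => e.cost + f.cost + 1
  | sub e f => e.cost + f.cost + 1
  | mul e f => e.cost + f.cost + 1

/-- Run a program: the resulting memory and the number of steps. -/
def Program.run [Ring R] : Program → Store R → Store R × ℕ
  | skip, s => (s, 1)
  | setNat a idx e, s => (s.setNat a (s.index idx) (e.eval s), 1 + idx.length + e.cost)
  | setNum a idx e, s => (s.setNum a (s.index idx) (e.eval s), 1 + idx.length + e.cost)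
  | seq c d, s =>
    let r := c.run s
    let r' := d.run r.1
    (r'.1, r.2 + r'.2)
  | ite e f c d, s =>
    let r := if e.eval s ≤ f.eval s then c.run s else d.run s
    (r.1, 1 + e.cost + f.cost + r.2)
  | loop x e c, s =>
    Nat.rec (motive := fun _ => Store R × ℕ) (s, 1 + e.cost)
      (fun i r =>
        let r' := c.run (r.1.setNat x [] i)
        (r'.1, r.2 + 1 + r'.2))
      (e.eval s)

end Machine

/-! ### Inputs and outputs of the algorithm -/

/-- The input `(n, p, M)`: the polynomial is given by the list of its `m_p` monomials with their
coefficients, in any order.  Memory of natural numbers: `0 ↦ n`, `1 ↦ M`, `2 ↦ m_p`, `3[j] ↦` length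
of the `j`-th word, `4[j, k] ↦` the `k`-th letter of the `j`-th word (all counted from `0`).
Memory of numbers: `0[j] ↦` coefficient of the `j`-th word.  All other cells are `0`. -/
noncomputable def polyInput {n : ℕ} (p : NCPoly ℂ n) (M : ℕ)
    (words : Fin p.numMonomials ≃ p.coeff.support) : Machine.Store ℂ where
  nat
    | 0, [] => n
    | 1, [] => M
    | 2, [] => p.numMonomials
    | 3, [j] => if h : j < p.numMonomials then (words ⟨j, h⟩).1.length else 0
    | 4, [j, k] =>
      if h : j < p.numMonomials then ((words ⟨j, h⟩).1.toList.map Fin.val).getD k 0 else 0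
    | _, _ => 0
  num
    | 0, [j] => if h : j < p.numMonomials then p.coeff (words ⟨j, h⟩).1 else 0
    | _, _ => 0

/-- The input `(n, M, N, deg p, c, μ₁, …, μ_n)`.  Memory of natural numbers: `0 ↦ n`, `1 ↦ M`,
`5 ↦ N`, `6 ↦ deg p`.  Memory of numbers: `1 ↦ c`, `2[i, j, k, l] ↦` coefficient of `z ^ l` of the
`(j, k)` entry of `μᵢ` (all counted from `0`).  All other cells are `0`. -/
noncomputable def matrixInput {n N : ℕ} (p : NCPoly ℂ n) (M : ℕ)
    (μ : Fin n → Matrix (Fin N) (Fin N) (TruncPoly M)) : Machine.Store ℂ where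
  nat
    | 0, [] => n
    | 1, [] => M
    | 5, [] => N
    | 6, [] => p.deg
    | _, _ => 0
  num
    | 1, [] => p.constPart
    | 2, [i, j, k, l] =>
      if h : i < n ∧ j < N ∧ k < N ∧ l ≤ M then
        truncCoeff l (μ ⟨i, h.1⟩ ⟨j, h.2.1⟩ ⟨k, h.2.2.1⟩)
      else 0
    | _, _ => 0

/-- The memory holds the size `N` (natural number `5`), the constant term `c` (number `1`) and the
matrices `μᵢ` (numbers `2[i, j, k, l]`). -/
def HoldsEncoding {n N : ℕ} (p : NCPoly ℂ n) (M : ℕ)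
    (μ : Fin n → Matrix (Fin N) (Fin N) (TruncPoly M)) (st : Machine.Store ℂ) : Prop :=
  st.nat 5 [] = N ∧ st.num 1 [] = p.constPart ∧
    ∀ (i : Fin n) (j k : Fin N) (l : ℕ), l ≤ M →
      st.num 2 [(i : ℕ), (j : ℕ), (k : ℕ), l] = truncCoeff l (μ i j k)

/-- The memory holds the matrix `P` (numbers `3[j, k, l]`). -/
def HoldsMatrix {M N : ℕ} (P : Matrix (Fin N) (Fin N) (TruncPoly M)) (st : Machine.Store ℂ) :
    Prop :=
  ∀ (j k : Fin N) (l : ℕ), l ≤ M → st.num 3 [(j : ℕ), (k : ℕ), l] = truncCoeff l (P j k)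

/-- The memory holds the moments `τ(q(s) ^ m)` for `1 ≤ m ≤ M` (numbers `4[m]`) and the final output
`τ(p(s) ^ M)` (number `5`). -/
def HoldsMoments {A : Type*} [Ring A] [Algebra ℂ A] (τ : A →ₗ[ℂ] ℂ) {n : ℕ} (s : Fin n → A)
    (p : NCPoly ℂ n) (M : ℕ) (st : Machine.Store ℂ) : Prop :=
  (∀ m : ℕ, 1 ≤ m → m ≤ M → st.num 4 [m] = τ (p.reducedPart.evalAt s ^ m)) ∧
    st.num 5 [] = τ (p.evalAt s ^ M)

/-- `s₁, …, s_n` are freely independent standard semicircular elements of the W*-probability space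
`(A, τ)`. -/
structure IsFreeSemicircularSystem {A : Type*} [CStarAlgebra A] [PartialOrder A]
    [StarOrderedRing A] [WStarAlgebra A] (τ : A →ₗ[ℂ] ℂ) {n : ℕ} (s : Fin n → A) : Prop where
  state : IsFaithfulNormalTracialState τ
  semicircular : ∀ i, IsStandardSemicircular τ (s i)
  free : FreelyIndependent τ s

/-! The probabilistic input is the Schwinger–Dyson equation `NCPoly.schwinger_dyson`: τ(sᵢ w(s)) =
(τ ⊗ τ)(∂ᵢ w), with ∂ᵢ the free difference quotient. Both sides are linear in w, and polynomials are
spanned by alternating products of centred one-variable polynomials. Freeness kills both sides on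
products of length at least two; in length one the equation is the Catalan recursion. On words it
says that the moment of iw is the sum, over all factorisations w = u i v, of the moments of u and v.

The polynomials H₀ = 1, Hₖ₊₁ = 1 + ∑ᵢ (Xᵢ Hₖ)² obey the same recursion: the coefficient of iw in
Hₖ₊₁ is that of w in Hₖ Xᵢ Hₖ. Hence Hₖ has the correct moment as coefficient of every word of
length at most k (`NCPoly.coeff_pairingIterate`), and τ(r(s)) is the pairing of the coefficients of
r and Hₖ as soon as deg r ≤ k. On the other hand Pᵏ + I is Hₖ evaluated at the matrices μᵢ
(`matrixIterate_add_one`), so its (1, N) entry pairs Hₖ with the coefficients of (zq)^*, and the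
part of degree m in z pairs Hₖ with qᵐ. Taking k = (deg p) M covers all m ≤ M.

The programs are verified in a small Hoare logic with step bounds (`Machine.Runs`). One iteration
costs about n matrix products, each of N³ products of truncated polynomials, and (deg p) M
iterations are made. The binomial sum is evaluated by the Pascal-type recursion τ(pʲ⁺¹ qᵐ) = c τ(pʲ
qᵐ) + τ(pʲ qᵐ⁺¹), which needs no binomial coefficients.

A representation is read off the monomials as a weighted automaton: an initial state, a final state,
and a block of deg p numbers for each monomial, for the positions inside it. The last letter of a
monomial leads to the final state and also back to the initial one, which implements a^* = a (1 +
a^*) (`NCPoly.represents_edgeHom`). With N = 2 + m_p deg p the cost of the iteration becomes the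
bound of the whole algorithm. -/

open scoped TensorProduct

/-! ### Moments of a single semicircular element. -/

section OneVariable

theorem Finset.sum_range_of_odd_eq_zero {R : Type*} [AddCommMonoid R] (f : ℕ → R)
    (hf : ∀ r, Odd r → f r = 0) (k : ℕ) :
    ∑ r ∈ Finset.range (2 * k + 1), f r = ∑ t ∈ Finset.range (k + 1), f (2 * t) := by
  induction k with
  | zero => simp
  | succ k ih =>
    rw [show 2 * (k + 1) + 1 = 2 * k + 1 + 1 + 1 by ring, Finset.sum_range_succ,
      Finset.sum_range_succ, ih, hf _ ⟨k, rfl⟩, add_zero, Finset.sum_range_succ _ (k + 1)]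
    ring_nf

variable {A : Type*} [Ring A] [Algebra ℂ A] [Star A] {τ : A →ₗ[ℂ] ℂ} {s : A}

theorem IsStandardSemicircular.moment_even (h : IsStandardSemicircular τ s) (k : ℕ) :
    τ (s ^ (2 * k)) = catalan k := by
  rw [h.2, if_pos (even_two_mul k), Nat.mul_div_cancel_left _ (by norm_num),
    ← Nat.centralBinom_eq_two_mul_choose]
  have h1 := succ_mul_catalan_eq_centralBinom k
  rw [← h1]
  push_cast
  have h2 : (k : ℂ) + 1 ≠ 0 := by exact_mod_cast Nat.succ_ne_zero k
  field_simp

theorem IsStandardSemicircular.moment_odd (h : IsStandardSemicircular τ s) {m : ℕ} (hm : Odd m) :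
    τ (s ^ m) = 0 := by
  rw [h.2, if_neg (Nat.not_even_iff_odd.2 hm)]

/-- This is the Schwinger–Dyson equation for powers of one variable. For even m the indices r and m
- 1 - r have opposite parity, so every term has an odd moment; for m = 2k + 1 only even r survive
and Segner's recursion for the Catalan numbers remains. -/
theorem IsStandardSemicircular.moment_succ (h : IsStandardSemicircular τ s) (m : ℕ) :
    τ (s ^ (m + 1)) = ∑ r ∈ Finset.range m, τ (s ^ r) * τ (s ^ (m - 1 - r)) := by
  rcases Nat.even_or_odd m with hm | hm
  · rw [h.moment_odd hm.add_one, Finset.sum_eq_zero]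
    intro r hr
    rw [Finset.mem_range] at hr
    rcases Nat.even_or_odd r with hr' | hr'
    · rw [h.moment_odd (m := m - 1 - r), mul_zero]
      rw [Nat.odd_iff]
      rw [Nat.even_iff] at hm hr'
      omega
    · rw [h.moment_odd hr', zero_mul]
  · obtain ⟨k, rfl⟩ := hm
    rw [Finset.sum_range_of_odd_eq_zero _ fun r hr => by rw [h.moment_odd hr, zero_mul],
      show 2 * k + 1 + 1 = 2 * (k + 1) by ring, h.moment_even, catalan_succ,
      ← Fin.sum_univ_eq_sum_range (fun t => τ (s ^ (2 * t)) * τ (s ^ (2 * k + 1 - 1 - 2 * t)))]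
    push_cast
    refine Finset.sum_congr rfl fun i _ => ?_
    rw [show 2 * k - 2 * (i : ℕ) = 2 * (k - i) by omega, h.moment_even, h.moment_even]

end OneVariable

/-! ### Alternating products of centred polynomials. -/

section Freeness

variable {A : Type*} [Ring A] [Algebra ℂ A] {τ : A →ₗ[ℂ] ℂ} {n : ℕ} {x : Fin n → A}

/-- A list of polynomials in alternating variables, each of them centred. -/
def IsAlternatingCentred (τ : A →ₗ[ℂ] ℂ) (x : Fin n → A) (l : List (Fin n × ℂ[X])) : Prop :=
  l.IsChain (fun a b => a.1 ≠ b.1) ∧ ∀ a ∈ l, τ (Polynomial.aeval (x a.1) a.2) = 0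

/-- The product of polynomials in elements of an algebra. -/
noncomputable def listProd {B : Type*} [Ring B] [Algebra ℂ B] (x : Fin n → B)
    (l : List (Fin n × ℂ[X])) : B :=
  (l.map fun a => Polynomial.aeval (x a.1) a.2).prod

theorem listProd_nil {B : Type*} [Ring B] [Algebra ℂ B] (x : Fin n → B) :
    listProd x [] = 1 := rfl

theorem listProd_cons {B : Type*} [Ring B] [Algebra ℂ B] (x : Fin n → B) (a) (l) :
    listProd x (a :: l) = Polynomial.aeval (x a.1) a.2 * listProd x l := by
  simp [listProd]

theorem listProd_append {B : Type*} [Ring B] [Algebra ℂ B] (x : Fin n → B) (l l') :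
    listProd x (l ++ l') = listProd x l * listProd x l' := by
  simp [listProd]

theorem FreelyIndependent.listProd_eq_zero (h : FreelyIndependent τ x) {l : List (Fin n × ℂ[X])}
    (hl : IsAlternatingCentred τ x l) (hne : l ≠ []) : τ (listProd x l) = 0 :=
  h l hne hl.1 hl.2

/-- Subtract the mean from a polynomial. -/
noncomputable def centre (τ : A →ₗ[ℂ] ℂ) (y : A) (P : ℂ[X]) : ℂ[X] :=
  P - Polynomial.C (τ (Polynomial.aeval y P))

theorem aeval_centre {B : Type*} [Ring B] [Algebra ℂ B] (y : A) (z : B) (P : ℂ[X]) :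
    Polynomial.aeval z P = Polynomial.aeval z (centre τ y P) +
      (τ (Polynomial.aeval y P)) • (1 : B) := by
  simp [centre, Algebra.algebraMap_eq_smul_one]

theorem map_aeval_centre (h1 : τ 1 = 1) (y : A) (P : ℂ[X]) :
    τ (Polynomial.aeval y (centre τ y P)) = 0 := by
  simp [centre, Algebra.algebraMap_eq_smul_one, h1]

/-- The last factor `P` need not be centred: its centred part prolongs the alternating product, and
its mean multiplies the trace of the nonempty product `l`, which is zero already. -/
theorem FreelyIndependent.mul_aeval_eq_zero (h : FreelyIndependent τ x) (h1 : τ 1 = 1)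
    {l : List (Fin n × ℂ[X])} (hl : IsAlternatingCentred τ x l) (hne : l ≠ []) (j : Fin n)
    (hj : ∀ a ∈ l.getLast?, a.1 ≠ j) (P : ℂ[X]) :
    τ (listProd x l * Polynomial.aeval (x j) P) = 0 := by
  rw [aeval_centre (τ := τ) (x j) (x j) P, mul_add, map_add, mul_smul_comm, mul_one, map_smul,
    h.listProd_eq_zero hl hne, smul_zero, add_zero]
  have h2 := h.listProd_eq_zero (l := l ++ [(j, centre τ (x j) P)]) ⟨?_, ?_⟩ (by simp)
  · simpa [listProd_append, listProd_cons, listProd_nil] using h2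
  · rw [List.isChain_append]
    refine ⟨hl.1, by simp, ?_⟩
    intro a ha b hb
    simp only [List.head?_cons, Option.mem_def, Option.some.injEq] at hb
    subst hb
    exact hj a ha
  · intro a ha
    rw [List.mem_append, List.mem_singleton] at ha
    rcases ha with ha | rfl
    · exact hl.2 a ha
    · exact map_aeval_centre h1 _ _

theorem FreelyIndependent.aeval_mul_eq_zero (h : FreelyIndependent τ x) (h1 : τ 1 = 1)
    {l : List (Fin n × ℂ[X])} (hl : IsAlternatingCentred τ x l) (hne : l ≠ []) (j : Fin n)
    (hj : ∀ a ∈ l.head?, j ≠ a.1) (P : ℂ[X]) :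
    τ (Polynomial.aeval (x j) P * listProd x l) = 0 := by
  rw [aeval_centre (τ := τ) (x j) (x j) P, add_mul, map_add, smul_mul_assoc, one_mul, map_smul,
    h.listProd_eq_zero hl hne, smul_zero, add_zero]
  have h2 := h.listProd_eq_zero (l := (j, centre τ (x j) P) :: l) ⟨?_, ?_⟩ (by simp)
  · simpa [listProd_cons] using h2
  · rw [List.isChain_cons]
    exact ⟨hj, hl.1⟩
  · intro a ha
    rw [List.mem_cons] at ha
    rcases ha with rfl | ha
    · exact map_aeval_centre h1 _ _
    · exact hl.2 a ha

end Freeness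

/-! ### Free difference quotients and the Schwinger–Dyson equation. -/

namespace NCPoly

variable {n : ℕ}

/-- The variables. -/
noncomputable def var (i : Fin n) : NCPoly ℂ n := MonoidAlgebra.of ℂ _ (FreeMonoid.of i)

/-- The monomial given by a word. -/
noncomputable def word (w : FreeMonoid (Fin n)) : NCPoly ℂ n := MonoidAlgebra.of ℂ _ w

theorem word_one : (word 1 : NCPoly ℂ n) = 1 := map_one _

theorem word_of_mul (i : Fin n) (w : FreeMonoid (Fin n)) :
    word (FreeMonoid.of i * w) = var i * word w := map_mul _ _ _

section Eval

variable {A : Type*} [Ring A] [Algebra ℂ A] (x : Fin n → A)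

theorem evalAt_var (i : Fin n) : evalAt x (var i) = x i := by
  simp [evalAt, var]

theorem evalAt_listProd (l : List (Fin n × ℂ[X])) :
    evalAt x (listProd var l) = listProd x l := by
  simp only [listProd, map_list_prod, List.map_map]
  congr 1
  refine List.map_congr_left fun a _ => ?_
  simp [← Polynomial.aeval_algHom_apply, evalAt_var]

/-- The span contains 1, so it suffices that it is stable under left multiplication by a variable. A
variable different from the one in front is a new centred factor, because its mean is zero. -/
theorem listProd_span {τ : A →ₗ[ℂ] ℂ} (h1 : τ 1 = 1) (h0 : ∀ i, τ (x i) = 0) :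
    Submodule.span ℂ {w : NCPoly ℂ n | ∃ l, IsAlternatingCentred τ x l ∧ listProd var l = w} = ⊤ := by
  set S := Submodule.span ℂ
    {w : NCPoly ℂ n | ∃ l, IsAlternatingCentred τ x l ∧ listProd var l = w} with hS
  have hmul : ∀ (j : Fin n) (w : NCPoly ℂ n), w ∈ S → var j * w ∈ S := by
    intro j w hw
    induction hw using Submodule.span_induction with
    | zero => simp
    | add u v _ _ hu hv => rw [mul_add]; exact S.add_mem hu hv
    | smul c u _ hu => rw [mul_smul_comm]; exact S.smul_mem _ hu
    | mem w hw =>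
      obtain ⟨l, hl, rfl⟩ := hw
      by_cases hj : ∀ a ∈ l.head?, j ≠ a.1
      · refine Submodule.subset_span ⟨(j, Polynomial.X) :: l, ⟨?_, ?_⟩, ?_⟩
        · rw [List.isChain_cons]
          exact ⟨hj, hl.1⟩
        · intro a ha
          rw [List.mem_cons] at ha
          rcases ha with rfl | ha
          · simp [h0]
          · exact hl.2 a ha
        · simp [listProd_cons]
      · push Not at hj
        obtain ⟨a, ha, rfl⟩ := hj
        cases l with
        | nil => simp at ha
        | cons b l =>
          simp only [List.head?_cons, Option.mem_def, Option.some.injEq] at ha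
          subst ha
          obtain ⟨hc, hm⟩ := hl
          rw [List.isChain_cons] at hc
          -- An equal variable is absorbed into the first factor, which is centred again; the mean
          -- leaves the alternating product without its first factor.
          have key : var b.1 * listProd var (b :: l) =
              listProd var ((b.1, centre τ (x b.1) (Polynomial.X * b.2)) :: l) +
                τ (Polynomial.aeval (x b.1) (Polynomial.X * b.2)) • listProd var l := by
            rw [listProd_cons, listProd_cons, ← mul_assoc]
            have := aeval_centre (τ := τ) (x b.1) (var b.1) (Polynomial.X * b.2)
            rw [map_mul, Polynomial.aeval_X] at this
            rw [this, add_mul, smul_mul_assoc, one_mul]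
          rw [key]
          refine S.add_mem (Submodule.subset_span ⟨_, ⟨?_, ?_⟩, rfl⟩)
            (S.smul_mem _ (Submodule.subset_span ⟨_, ⟨hc.2, ?_⟩, rfl⟩))
          · rw [List.isChain_cons]
            exact hc
          · intro a ha
            rw [List.mem_cons] at ha
            rcases ha with rfl | ha
            · exact map_aeval_centre h1 _ _
            · exact hm a (List.mem_cons_of_mem _ ha)
          · exact fun a ha => hm a (List.mem_cons_of_mem _ ha)
  have hword : ∀ w : FreeMonoid (Fin n), word w ∈ S := by
    intro w
    induction w using FreeMonoid.recOn with
    | one => exact Submodule.subset_span ⟨[], ⟨by simp, by simp⟩, by simp [listProd_nil, word_one]⟩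
    | of_mul a w ih => rw [word_of_mul]; exact hmul _ _ ih
  rw [eq_top_iff]
  intro w _
  induction w using MonoidAlgebra.induction_on with
  | of m => exact hword m
  | add u v hu hv => exact S.add_mem (hu trivial) (hv trivial)
  | smul r u hu => exact S.smul_mem _ (hu trivial)

/-- The homomorphism whose upper right entry is the free difference quotient. -/
noncomputable def diffHom (i : Fin n) : NCPoly ℂ n →ₐ[ℂ] Matrix (Fin 2) (Fin 2) (A ⊗[ℂ] A) :=
  evalAt fun j => !![x j ⊗ₜ 1, if j = i then 1 else 0; 0, 1 ⊗ₜ x j]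

/-- The free difference quotient, with both legs evaluated. -/
noncomputable def diffQuot (i : Fin n) (w : NCPoly ℂ n) : A ⊗[ℂ] A := diffHom x i w 0 1

theorem diffQuot_add (i : Fin n) (u v : NCPoly ℂ n) :
    diffQuot x i (u + v) = diffQuot x i u + diffQuot x i v := by
  simp [diffQuot]

theorem diffQuot_smul (i : Fin n) (c : ℂ) (u : NCPoly ℂ n) :
    diffQuot x i (c • u) = c • diffQuot x i u := by
  simp [diffQuot]

theorem diffQuot_one (i : Fin n) : diffQuot x i 1 = 0 := by
  simp [diffQuot]

theorem diffQuot_var (i j : Fin n) : diffQuot x i (var j) = if j = i then 1 else 0 := by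
  simp [diffQuot, diffHom, evalAt_var]

/-- The images are upper triangular, with the two evaluations into the legs on the diagonal. The
upper right entry of a product is therefore given by the Leibniz rule. -/
theorem diffHom_diag (i : Fin n) (u : NCPoly ℂ n) :
    diffHom x i u 0 0 = evalAt x u ⊗ₜ 1 ∧ diffHom x i u 1 1 = 1 ⊗ₜ evalAt x u ∧
      diffHom x i u 1 0 = 0 := by
  induction u using MonoidAlgebra.induction_on with
  | of w =>
    induction w using FreeMonoid.recOn with
    | one => rw [map_one]; simp [Algebra.TensorProduct.one_def]
    | of_mul a w ih =>
      obtain ⟨ih1, ih2, ih3⟩ := ih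
      have hv : diffHom x i (MonoidAlgebra.of ℂ _ (FreeMonoid.of a)) =
        !![x a ⊗ₜ 1, if a = i then 1 else 0; 0, 1 ⊗ₜ x a] := evalAt_var _ _
      have hw : evalAt x (MonoidAlgebra.of ℂ _ (FreeMonoid.of a)) = x a := evalAt_var _ _
      rw [map_mul, map_mul, map_mul, Matrix.mul_apply, Matrix.mul_apply, Matrix.mul_apply,
        Fin.sum_univ_two, Fin.sum_univ_two, Fin.sum_univ_two, ih1, ih2, ih3, hv, hw]
      simp
  | add u v hu hv =>
    simp [hu, hv, TensorProduct.add_tmul, TensorProduct.tmul_add]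
  | smul r u hu => simp [hu, TensorProduct.smul_tmul']

theorem diffQuot_mul (i : Fin n) (u v : NCPoly ℂ n) :
    diffQuot x i (u * v) = (evalAt x u ⊗ₜ 1) * diffQuot x i v +
      diffQuot x i u * (1 ⊗ₜ evalAt x v) := by
  rw [diffQuot, map_mul, Matrix.mul_apply, Fin.sum_univ_two, (diffHom_diag x i u).1,
    (diffHom_diag x i v).2.1, diffQuot, diffQuot]

theorem diffQuot_var_pow (i : Fin n) (m : ℕ) :
    diffQuot x i (var i ^ m) = ∑ r ∈ Finset.range m, (x i ^ r) ⊗ₜ[ℂ] (x i ^ (m - 1 - r)) := by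
  induction m with
  | zero => simp [diffQuot_one]
  | succ m ih =>
    rw [pow_succ', diffQuot_mul, ih, diffQuot_var, if_pos rfl, evalAt_var, map_pow, evalAt_var,
      one_mul, Finset.mul_sum, Finset.sum_range_succ']
    congr 1
    · refine Finset.sum_congr rfl fun r hr => ?_
      rw [Algebra.TensorProduct.tmul_mul_tmul, one_mul, ← pow_succ']
      congr 2
      omega
    · simp

theorem diffQuot_var_pow_of_ne {i j : Fin n} (h : j ≠ i) (m : ℕ) :
    diffQuot x i (var j ^ m) = 0 := by
  induction m with
  | zero => simp [diffQuot_one]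
  | succ m ih => rw [pow_succ', diffQuot_mul, ih, diffQuot_var, if_neg h]; simp

/-- The difference quotient of a polynomial in the variable `j` is a combination of tensors of two
powers of that variable, and it is zero if `j ≠ i`. -/
theorem map_diffQuot_aeval_eq_zero (i j : Fin n) (B : A ⊗[ℂ] A →ₗ[ℂ] ℂ)
    (hB : ∀ P Q : ℂ[X], B (Polynomial.aeval (x j) P ⊗ₜ Polynomial.aeval (x j) Q) = 0) (P : ℂ[X]) :
    B (diffQuot x i (Polynomial.aeval (var j) P)) = 0 := by
  induction P using Polynomial.induction_on' with
  | add P Q hP hQ => rw [map_add, diffQuot_add, map_add, hP, hQ, add_zero]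
  | monomial m c =>
    rw [Polynomial.aeval_monomial, ← Algebra.smul_def, diffQuot_smul, map_smul]
    by_cases h : j = i
    · subst h
      rw [diffQuot_var_pow, map_sum, Finset.sum_eq_zero, smul_zero]
      intro r _
      simpa using hB (Polynomial.X ^ r) (Polynomial.X ^ (m - 1 - r))
    · rw [diffQuot_var_pow_of_ne x h, map_zero, smul_zero]

end Eval

section SchwingerDyson

variable {A : Type*} [Ring A] [Algebra ℂ A] {τ : A →ₗ[ℂ] ℂ} {x : Fin n → A}

/-- The product functional `τ ⊗ τ`. -/
noncomputable def tensorSquare (τ : A →ₗ[ℂ] ℂ) : A ⊗[ℂ] A →ₗ[ℂ] ℂ :=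
  LinearMap.mul' ℂ ℂ ∘ₗ TensorProduct.map τ τ

theorem tensorSquare_tmul (a b : A) : tensorSquare τ (a ⊗ₜ b) = τ a * τ b := by
  simp [tensorSquare]

/-- In each Leibniz term the left leg is a nonempty alternating product followed by a polynomial in
the next variable, so `τ` kills it. The induction moves factors from `l'` to the prefix `l`. -/
theorem tensorSquare_diffQuot_listProd_prefix (h1 : τ 1 = 1) (hf : FreelyIndependent τ x)
    (i : Fin n) (l' l : List (Fin n × ℂ[X])) (hne : l ≠ [])
    (hl : IsAlternatingCentred τ x (l ++ l')) :
    tensorSquare τ ((listProd x l ⊗ₜ 1) * diffQuot x i (listProd var l')) = 0 := by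
  induction l' generalizing l with
  | nil => simp [listProd_nil, diffQuot_one]
  | cons a l' ih =>
    have h2 := ih (l ++ [a]) (by simp) (by simpa using hl)
    rw [listProd_append, listProd_cons, listProd_nil, mul_one] at h2
    rw [listProd_cons, diffQuot_mul, mul_add, map_add, ← mul_assoc,
      Algebra.TensorProduct.tmul_mul_tmul, one_mul, ← Polynomial.aeval_algHom_apply, evalAt_var, h2,
      zero_add]
    set B : A ⊗[ℂ] A →ₗ[ℂ] ℂ := tensorSquare τ ∘ₗ
      LinearMap.mulLeft ℂ (listProd x l ⊗ₜ[ℂ] (1 : A)) ∘ₗ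
      LinearMap.mulRight ℂ ((1 : A) ⊗ₜ[ℂ] evalAt x (listProd var l')) with hB
    have h3 := map_diffQuot_aeval_eq_zero x i a.1 B ?_ a.2
    · simpa [hB] using h3
    · intro P Q
      simp only [hB, LinearMap.comp_apply, LinearMap.mulRight_apply, LinearMap.mulLeft_apply,
        Algebra.TensorProduct.tmul_mul_tmul, tensorSquare_tmul, one_mul, mul_one]
      obtain ⟨hc, hm⟩ := hl
      rw [List.isChain_append] at hc
      rw [hf.mul_aeval_eq_zero h1 ⟨hc.1, fun b hb => hm b (List.mem_append_left _ hb)⟩ hne, zero_mul]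
      exact fun b hb => hc.2.2 b hb a (by simp)

/-- The Schwinger–Dyson equation of a free semicircular family. -/
theorem schwinger_dyson [Star A] (h1 : τ 1 = 1) (hs : ∀ i, IsStandardSemicircular τ (x i))
    (hf : FreelyIndependent τ x) (i : Fin n) (w : NCPoly ℂ n) :
    τ (x i * evalAt x w) = tensorSquare τ (diffQuot x i w) := by
  have h0 : ∀ i, τ (x i) = 0 := fun i => by simpa using (hs i).moment_odd (m := 1) odd_one
  have hw : w ∈ Submodule.span ℂ
      {w : NCPoly ℂ n | ∃ l, IsAlternatingCentred τ x l ∧ listProd var l = w} := by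
    rw [listProd_span x h1 h0]
    trivial
  induction hw using Submodule.span_induction with
  | zero => simp [diffQuot]
  | add u v _ _ hu hv => rw [map_add, mul_add, map_add, hu, hv, diffQuot_add, map_add]
  | smul c u _ hu => rw [map_smul, mul_smul_comm, map_smul, hu, diffQuot_smul, map_smul]
  | mem w hw =>
    obtain ⟨l, hl, rfl⟩ := hw
    rw [evalAt_listProd]
    -- In length zero both sides vanish. In length one the equation is the Catalan recursion if the
    -- variable is `i`, and otherwise both sides vanish. In length at least two both sides always
    -- vanish.
    match l, hl with
    | [], _ => simp [listProd_nil, h0, diffQuot_one]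
    | [(j, P)], hl =>
      by_cases hj : j = i
      · subst hj
        simp only [listProd_cons, listProd_nil, mul_one]
        clear hl
        induction P using Polynomial.induction_on' with
        | add P Q hP hQ => simp only [map_add, mul_add, diffQuot_add, hP, hQ]
        | monomial m c =>
          rw [Polynomial.aeval_monomial, Polynomial.aeval_monomial, ← Algebra.smul_def,
            ← Algebra.smul_def, diffQuot_smul, map_smul, diffQuot_var_pow, map_sum, mul_smul_comm,
            map_smul, ← pow_succ', (hs j).moment_succ]
          simp only [tensorSquare_tmul]
      · have h2 := hf.aeval_mul_eq_zero h1 hl (by simp) i (by simpa using Ne.symm hj) Polynomial.X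
        rw [Polynomial.aeval_X] at h2
        rw [h2]
        simp only [listProd_cons, listProd_nil, mul_one]
        clear hl h2
        induction P using Polynomial.induction_on' with
        | add P Q hP hQ => rw [map_add, diffQuot_add, map_add, ← hP, ← hQ, add_zero]
        | monomial m c =>
          rw [Polynomial.aeval_monomial, ← Algebra.smul_def, diffQuot_smul,
            diffQuot_var_pow_of_ne x hj, smul_zero, map_zero]
    | a :: b :: l, hl =>
      have hl' := hl
      obtain ⟨hc, hm⟩ := hl
      rw [List.isChain_cons] at hc
      have hbl : IsAlternatingCentred τ x (b :: l) :=
        ⟨hc.2, fun c hc => hm c (List.mem_cons_of_mem _ hc)⟩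
      -- If the derivative hits a factor after `a`, the left leg has trace zero by the prefix lemma.
      -- If it hits `a`, the right leg is a polynomial in the variable of `a` in front of the
      -- nonempty product `b :: l`.
      have hr : tensorSquare τ (diffQuot x i (listProd var (a :: b :: l))) = 0 := by
        rw [listProd_cons, diffQuot_mul, map_add, ← Polynomial.aeval_algHom_apply, evalAt_var]
        have h2 := tensorSquare_diffQuot_listProd_prefix h1 hf i (b :: l) [a] (by simp) hl'
        rw [listProd_cons x a, listProd_nil, mul_one] at h2
        rw [h2, zero_add]
        have h3 := map_diffQuot_aeval_eq_zero x i a.1 (tensorSquare τ ∘ₗ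
          LinearMap.mulRight ℂ ((1 : A) ⊗ₜ[ℂ] evalAt x (listProd var (b :: l)))) ?_ a.2
        · simpa using h3
        · intro P Q
          simp only [LinearMap.comp_apply, LinearMap.mulRight_apply,
            Algebra.TensorProduct.tmul_mul_tmul, tensorSquare_tmul, mul_one, evalAt_listProd]
          rw [hf.aeval_mul_eq_zero h1 hbl (by simp) a.1 hc.1, mul_zero]
      rw [hr]
      -- On the left side, `x i` either merges with the first factor, in front of `b :: l`, or is
      -- itself a polynomial in front of the whole product.
      by_cases hj : a.1 = i
      · rw [listProd_cons, ← mul_assoc]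
        have h2 := hf.aeval_mul_eq_zero h1 hbl (by simp) i (by rw [← hj]; exact hc.1)
          (Polynomial.X * a.2)
        rw [map_mul (Polynomial.aeval (x i)), Polynomial.aeval_X] at h2
        rw [hj]
        exact h2
      · have h2 := hf.aeval_mul_eq_zero h1 hl' (by simp) i (by simpa using Ne.symm hj) Polynomial.X
        rwa [Polynomial.aeval_X] at h2

end SchwingerDyson

end NCPoly

/-! ### Coefficients of words and the iterates Hₖ. -/

namespace NCPoly

section Coefficients

variable {R : Type*} [Semiring R] {n : ℕ}

theorem coeff_mul_ofList (a b : NCPoly R n) (w : List (Fin n)) :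
    (a * b).coeff (FreeMonoid.ofList w) = ∑ k ∈ Finset.range (w.length + 1),
      a.coeff (FreeMonoid.ofList (w.take k)) * b.coeff (FreeMonoid.ofList (w.drop k)) := by
  classical
  rw [MonoidAlgebra.coeff_mul_antidiag a b _ ((Finset.range (w.length + 1)).image fun k =>
    (FreeMonoid.ofList (w.take k), FreeMonoid.ofList (w.drop k)))]
  · rw [Finset.sum_image]
    intro k hk l hl hkl
    simp only [Finset.coe_range, Set.mem_Iio] at hk hl
    have h := congrArg (fun u => u.1.length) hkl
    change (w.take k).length = (w.take l).length at h
    rw [List.length_take, List.length_take] at h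
    omega
  · rintro ⟨u, v⟩
    simp only [Finset.mem_image, Finset.mem_range, Prod.mk.injEq]
    constructor
    · rintro ⟨k, _, rfl, rfl⟩
      rw [← FreeMonoid.ofList_append, List.take_append_drop]
    · intro h
      have h' : u.toList ++ v.toList = w := by
        rw [← FreeMonoid.toList_mul, h, FreeMonoid.toList_ofList]
      refine ⟨u.toList.length, ?_, ?_, ?_⟩
      · rw [← h', List.length_append]
        omega
      · rw [← h', List.take_left, FreeMonoid.ofList_toList]
      · rw [← h', List.drop_left, FreeMonoid.ofList_toList]

theorem coeff_single_of_mul_cons (i j : Fin n) (r : R) (b : NCPoly R n) (w : List (Fin n)) :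
    (MonoidAlgebra.single (FreeMonoid.of i) r * b).coeff (FreeMonoid.ofList (j :: w)) =
      if j = i then r * b.coeff (FreeMonoid.ofList w) else 0 := by
  split_ifs with h
  · subst h
    refine MonoidAlgebra.coeff_single_mul_eq_mul_coeff (FreeMonoid.ofList w) fun v _ => ?_
    rw [FreeMonoid.ofList_cons]
    exact mul_right_inj _
  · refine MonoidAlgebra.coeff_single_mul_of_forall_mul_ne _ _ fun v hv => h ?_
    have := congrArg FreeMonoid.toList hv
    rw [FreeMonoid.toList_of_mul] at this
    exact (List.cons.inj this).1.symm

theorem coeff_single_of_mul_nil (i : Fin n) (r : R) (b : NCPoly R n) :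
    (MonoidAlgebra.single (FreeMonoid.of i) r * b).coeff 1 = 0 := by
  refine MonoidAlgebra.coeff_single_mul_of_forall_mul_ne _ _ fun v hv => ?_
  have := congrArg FreeMonoid.toList hv
  rw [FreeMonoid.toList_of_mul] at this
  simp at this

theorem length_le_of_coeff_pow_ne_zero (a : NCPoly R n) (d : ℕ)
    (ha : ∀ F, a.coeff F ≠ 0 → F.length ≤ d) (m : ℕ) (F : FreeMonoid (Fin n))
    (hF : (a ^ m).coeff F ≠ 0) : F.length ≤ m * d := by
  induction m generalizing F with
  | zero =>
    classical
    by_contra h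
    apply hF
    rw [pow_zero, MonoidAlgebra.one_def, MonoidAlgebra.coeff_single, Finsupp.single_apply, if_neg]
    rintro rfl
    simp at h
  | succ m ih =>
    rw [← FreeMonoid.ofList_toList F, pow_succ, coeff_mul_ofList] at hF
    obtain ⟨k, _, hk⟩ := Finset.exists_ne_zero_of_sum_ne_zero hF
    have h1 := ih _ (left_ne_zero_of_mul hk)
    have h2 := ha _ (right_ne_zero_of_mul hk)
    change (F.toList.take k).length ≤ _ at h1
    change (F.toList.drop k).length ≤ _ at h2
    change F.toList.length ≤ _
    rw [List.length_take] at h1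
    rw [List.length_drop] at h2
    rw [Nat.succ_mul]
    omega

end Coefficients

section Iterate

variable {n : ℕ}

/-- The noncommutative polynomials `H₀ = 1`, `Hₖ₊₁ = 1 + ∑ᵢ (Xᵢ Hₖ)²`, which count noncrossing
pairings of bounded height. -/
noncomputable def pairingIterate (n : ℕ) : ℕ → NCPoly ℂ n
  | 0 => 1
  | k + 1 => ∑ i, (var i * pairingIterate n k) ^ 2 + 1

theorem coeff_one_ofList_cons {R : Type*} [Semiring R] (i : Fin n) (w : List (Fin n)) :
    (1 : NCPoly R n).coeff (FreeMonoid.ofList (i :: w)) = 0 := by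
  classical
  rw [MonoidAlgebra.one_def, MonoidAlgebra.coeff_single, Finsupp.single_apply, if_neg]
  intro h
  simpa using congrArg FreeMonoid.toList h

theorem coeff_var_mul_cons (i j : Fin n) (b : NCPoly ℂ n) (w : List (Fin n)) :
    (var i * b).coeff (FreeMonoid.ofList (j :: w)) =
      if j = i then b.coeff (FreeMonoid.ofList w) else 0 := by
  have := coeff_single_of_mul_cons i j 1 b w
  simpa [var] using this

theorem coeff_var_mul_nil (i : Fin n) (b : NCPoly ℂ n) :
    (var i * b).coeff (FreeMonoid.ofList []) = 0 := coeff_single_of_mul_nil i 1 b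

theorem coeff_pairingIterate_nil (k : ℕ) : (pairingIterate n k).coeff (FreeMonoid.ofList []) = 1 := by
  cases k with
  | zero => exact MonoidAlgebra.coeff_one_one
  | succ k =>
    rw [pairingIterate, MonoidAlgebra.coeff_add, Finsupp.add_apply, MonoidAlgebra.coeff_sum,
      Finsupp.finsetSum_apply, Finset.sum_eq_zero, zero_add]
    · exact MonoidAlgebra.coeff_one_one
    · intro i _
      rw [pow_two, mul_assoc, coeff_var_mul_nil]

/-- The first letter selects the summand (Xᵢ Hₖ)² = Xᵢ (Hₖ Xᵢ Hₖ). The inner Xᵢ is the partner of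
the first letter in a noncrossing pairing; the two copies of Hₖ pair the letters between them and
after them. -/
theorem coeff_pairingIterate_cons (k : ℕ) (i : Fin n) (w : List (Fin n)) :
    (pairingIterate n (k + 1)).coeff (FreeMonoid.ofList (i :: w)) =
      (pairingIterate n k * (var i * pairingIterate n k)).coeff (FreeMonoid.ofList w) := by
  rw [pairingIterate, MonoidAlgebra.coeff_add, Finsupp.add_apply, MonoidAlgebra.coeff_sum,
      Finsupp.finsetSum_apply, coeff_one_ofList_cons, add_zero]
  simp only [pow_two, mul_assoc, coeff_var_mul_cons]
  simp

variable {A : Type*} [Ring A] [Algebra ℂ A] {τ : A →ₗ[ℂ] ℂ} {x : Fin n → A}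

theorem diffQuot_word_of_mul (i j : Fin n) (w : FreeMonoid (Fin n)) :
    diffQuot x i (word (FreeMonoid.of j * w)) = (x j ⊗ₜ 1) * diffQuot x i (word w) +
      if j = i then 1 ⊗ₜ evalAt x (word w) else 0 := by
  rw [word_of_mul, diffQuot_mul, diffQuot_var, evalAt_var]
  split_ifs <;> simp

/-- `a` and `b` are the sequences of moments on words, respectively on words that start with `i`
(with the letter `i` removed). -/
theorem tensorSquare_mul_diffQuot_word (i : Fin n) (a b : FreeMonoid (Fin n) → ℂ)
    (w : List (Fin n)) (U : A)
    (ha : ∀ k, τ (U * evalAt x (word (FreeMonoid.ofList (w.take k)))) =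
      a (FreeMonoid.ofList (w.take k)))
    (hb : ∀ k j v, w.drop k = j :: v → b (FreeMonoid.ofList (w.drop k)) =
      if j = i then τ (evalAt x (word (FreeMonoid.ofList v))) else 0)
    (hb0 : b 1 = 0) :
    tensorSquare τ ((U ⊗ₜ 1) * diffQuot x i (word (FreeMonoid.ofList w))) =
      ∑ k ∈ Finset.range (w.length + 1),
        a (FreeMonoid.ofList (w.take k)) * b (FreeMonoid.ofList (w.drop k)) := by
  induction w generalizing U a with
  | nil =>
    rw [FreeMonoid.ofList_nil, word_one, diffQuot_one]
    simp [hb0]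
  | cons j w ih =>
    -- The term k = 0 comes from differentiating the first letter `j`. In all other terms `j` stays
    -- on the left and joins `U`.
    rw [List.length_cons, Finset.sum_range_succ', FreeMonoid.ofList_cons, diffQuot_word_of_mul,
      mul_add, ← mul_assoc, Algebra.TensorProduct.tmul_mul_tmul, one_mul, map_add]
    congr 1
    · rw [ih (fun v => a (FreeMonoid.of j * v)) (U * x j)]
      · rfl
      · intro k
        have := ha (k + 1)
        rwa [List.take_succ_cons, FreeMonoid.ofList_cons, word_of_mul, map_mul (evalAt x), evalAt_var,
          ← mul_assoc] at this
      · intro k j' v h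
        exact hb (k + 1) j' v h
    · have h0 := ha 0
      rw [List.take_zero, FreeMonoid.ofList_nil, word_one, map_one, mul_one] at h0
      rw [List.take_zero, FreeMonoid.ofList_nil, ← h0, hb 0 j w rfl]
      split_ifs
      · rw [Algebra.TensorProduct.tmul_mul_tmul, mul_one, one_mul, tensorSquare_tmul]
      · simp

/-- The iterates compute the moments of words of bounded length. -/
theorem coeff_pairingIterate [Star A] (h1 : τ 1 = 1) (hs : ∀ i, IsStandardSemicircular τ (x i))
    (hf : FreelyIndependent τ x) (k : ℕ) (w : List (Fin n)) (hw : w.length ≤ k) :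
    (pairingIterate n k).coeff (FreeMonoid.ofList w) =
      τ (evalAt x (word (FreeMonoid.ofList w))) := by
  induction k generalizing w with
  | zero =>
    rw [List.eq_nil_of_length_eq_zero (by omega : w.length = 0), coeff_pairingIterate_nil,
      FreeMonoid.ofList_nil, word_one, map_one, h1]
  | succ k ih =>
    cases w with
    | nil => rw [coeff_pairingIterate_nil, FreeMonoid.ofList_nil, word_one, map_one, h1]
    | cons i w =>
      rw [List.length_cons] at hw
      rw [FreeMonoid.ofList_cons, word_of_mul, map_mul (evalAt x), evalAt_var, schwinger_dyson h1 hs hf,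
        ← FreeMonoid.ofList_cons, coeff_pairingIterate_cons, coeff_mul_ofList]
      rw [← one_mul (diffQuot x i _), Algebra.TensorProduct.one_def]
      refine (tensorSquare_mul_diffQuot_word i _ _ w 1 ?_ ?_ (coeff_var_mul_nil i _)).symm
      · intro l
        rw [one_mul, ih]
        rw [List.length_take]
        omega
      · intro l j v h
        rw [h, coeff_var_mul_cons, ih]
        have := congrArg List.length h
        rw [List.length_drop, List.length_cons] at this
        omega

/-- On the support of `p` the coefficients of Hₖ are the moments. The sum is moved from the support
of `p` to that of Hₖ through their union, because evaluating Hₖ at matrices produces a sum over its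
own support. -/
theorem map_evalAt_eq_sum [Star A] (h1 : τ 1 = 1) (hs : ∀ i, IsStandardSemicircular τ (x i))
    (hf : FreelyIndependent τ x) (p : NCPoly ℂ n) (k : ℕ)
    (hp : ∀ F, p.coeff F ≠ 0 → F.length ≤ k) :
    τ (evalAt x p) = (pairingIterate n k).coeff.sum fun F c => c * p.coeff F := by
  classical
  have hL : τ (evalAt x p) = p.coeff.sum fun F c => c * (pairingIterate n k).coeff F := by
    rw [evalAt, MonoidAlgebra.lift_apply, Finsupp.sum, Finsupp.sum, map_sum]
    refine Finset.sum_congr rfl fun F hF => ?_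
    rw [map_smul, smul_eq_mul, ← FreeMonoid.ofList_toList F, coeff_pairingIterate h1 hs hf]
    · simp [word, evalAt]
    · exact hp F (Finsupp.mem_support_iff.1 hF)
  rw [hL, Finsupp.sum_of_support_subset _ (Finset.subset_union_left (s₂ := (pairingIterate n k).coeff.support))
    _ (by simp), Finsupp.sum_of_support_subset _ (Finset.subset_union_right (s₁ := p.coeff.support)) _ (by simp)]
  exact Finset.sum_congr rfl fun F _ => mul_comm _ _

end Iterate

section Reduced

variable {n : ℕ}

theorem coeff_reducedPart (p : NCPoly ℂ n) (F : FreeMonoid (Fin n)) [Decidable (F = 1)] :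
    p.reducedPart.coeff F = if F = 1 then 0 else p.coeff F := by
  classical
  rw [reducedPart, MonoidAlgebra.coeff_sub, MonoidAlgebra.coeff_single, Finsupp.sub_apply,
    Finsupp.single_apply]
  by_cases h : F = 1
  · simp [h, constPart]
  · simp [h, Ne.symm h]

theorem length_le_deg (p : NCPoly ℂ n) (F : FreeMonoid (Fin n)) (hF : p.coeff F ≠ 0) :
    F.length ≤ p.deg :=
  Finset.le_sup (f := FreeMonoid.length) (Finsupp.mem_support_iff.2 hF)

theorem length_le_deg_of_reducedPart (p : NCPoly ℂ n) (F : FreeMonoid (Fin n))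
    (hF : p.reducedPart.coeff F ≠ 0) : F.length ≤ p.deg := by
  classical
  apply length_le_deg
  rw [coeff_reducedPart] at hF
  split_ifs at hF
  · simp at hF
  · exact hF

theorem zMul_pow (q : NCPoly ℂ n) (k : ℕ) : q.zMul ^ k =
    (Polynomial.X ^ k : ℂ[X]) • MonoidAlgebra.mapRingHom (FreeMonoid (Fin n)) Polynomial.C (q ^ k) := by
  rw [zMul, smul_pow, map_pow]

theorem coeff_zMul_pow (q : NCPoly ℂ n) (k : ℕ) (F : FreeMonoid (Fin n)) :
    (q.zMul ^ k).coeff F = Polynomial.X ^ k * Polynomial.C ((q ^ k).coeff F) := by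
  rw [zMul_pow, MonoidAlgebra.coeff_smul, Finsupp.smul_apply, MonoidAlgebra.coeff_mapRingHom, smul_eq_mul]

/-- All coefficients of (zq)ᵏ are multiples of zᵏ by scalars, so only k = m contributes. If m
exceeds the length of the word, this term is missing from the sum, but it is zero. -/
theorem coeff_pseudoInverse_zMul (q : NCPoly ℂ n) (hq : q.coeff 1 = 0) (F : FreeMonoid (Fin n))
    {m : ℕ} (hm : 1 ≤ m) : (q.zMul.pseudoInverse F).coeff m = (q ^ m).coeff F := by
  rw [pseudoInverse, Polynomial.finsetSum_coeff]
  simp only [coeff_zMul_pow, mul_comm (Polynomial.X ^ _), Polynomial.coeff_C_mul_X_pow]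
  rw [Finset.sum_ite_eq]
  split_ifs with h
  · rfl
  · rw [coeff_pow_eq_zero q hq m F]
    rw [Finset.mem_Icc] at h
    omega

end Reduced

end NCPoly

/-! ### Coefficients modulo z^(M+1). -/

section TruncPoly

variable {M : ℕ}

theorem truncCoeff_mk {m : ℕ} (hm : m ≤ M) (f : ℂ[X]) :
    truncCoeff m (AdjoinRoot.mk (Polynomial.X ^ (M + 1) : ℂ[X]) f) = f.coeff m := by
  rw [truncCoeff, AdjoinRoot.modByMonicHom_mk]
  conv_rhs => rw [← Polynomial.modByMonic_add_div f (Polynomial.X ^ (M + 1))]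
  rw [Polynomial.coeff_add, Polynomial.coeff_X_pow_mul', if_neg (by omega), add_zero]

theorem truncCoeff_add (m : ℕ) (f g : TruncPoly M) :
    truncCoeff m (f + g) = truncCoeff m f + truncCoeff m g := by
  rw [truncCoeff, map_add, Polynomial.coeff_add]; rfl

theorem truncCoeff_zero (m : ℕ) : truncCoeff m (0 : TruncPoly M) = 0 := by
  rw [truncCoeff, map_zero, Polynomial.coeff_zero]

theorem truncCoeff_sum {ι : Type*} (m : ℕ) (s : Finset ι) (f : ι → TruncPoly M) :
    truncCoeff m (∑ i ∈ s, f i) = ∑ i ∈ s, truncCoeff m (f i) := by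
  rw [truncCoeff, map_sum, Polynomial.finsetSum_coeff]; rfl

theorem truncCoeff_smul (m : ℕ) (c : ℂ) (f : TruncPoly M) :
    truncCoeff m (c • f) = c * truncCoeff m f := by
  obtain ⟨f, rfl⟩ := AdjoinRoot.mk_surjective f
  rw [AdjoinRoot.smul_mk, truncCoeff, truncCoeff, AdjoinRoot.modByMonicHom_mk,
    AdjoinRoot.modByMonicHom_mk, Polynomial.smul_modByMonic, Polynomial.coeff_smul, smul_eq_mul]

theorem truncCoeff_one {m : ℕ} (hm : m ≤ M) :
    truncCoeff m (1 : TruncPoly M) = if m = 0 then 1 else 0 := by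
  rw [← map_one (AdjoinRoot.mk (Polynomial.X ^ (M + 1) : ℂ[X])), truncCoeff_mk hm,
    Polynomial.coeff_one]

theorem truncCoeff_mul {m : ℕ} (hm : m ≤ M) (f g : TruncPoly M) :
    truncCoeff m (f * g) = ∑ t ∈ Finset.range (m + 1), truncCoeff t f * truncCoeff (m - t) g := by
  obtain ⟨f, rfl⟩ := AdjoinRoot.mk_surjective f
  obtain ⟨g, rfl⟩ := AdjoinRoot.mk_surjective g
  rw [← map_mul, truncCoeff_mk hm, Polynomial.coeff_mul,
    Finset.Nat.sum_antidiagonal_eq_sum_range_succ_mk]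
  refine Finset.sum_congr rfl fun t ht => ?_
  rw [Finset.mem_range] at ht
  rw [truncCoeff_mk (by omega), truncCoeff_mk (by omega)]

end TruncPoly

/-! ### Correctness of the matrix iteration and the binomial formula. -/

section Correctness

open NCPoly

variable {n N M : ℕ}

/-- Shifted by the identity, the matrix recursion becomes that of Hₖ. -/
theorem matrixIterate_add_one (μ : Fin n → Matrix (Fin N) (Fin N) (TruncPoly M)) (k : ℕ) :
    matrixIterate μ k + 1 = evalAt μ (pairingIterate n k) := by
  induction k with
  | zero => simp [matrixIterate, pairingIterate]
  | succ k ih =>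
    rw [matrixIterate, pairingIterate, ih]
    simp [evalAt_var]

theorem evalAt_truncMatrices_word (μ : FreeMonoid (Fin n) →* Matrix (Fin N) (Fin N) ℂ[X])
    (F : FreeMonoid (Fin n)) :
    FreeMonoid.lift (truncMatrices M μ) F =
      (μ F).map (AdjoinRoot.mk (Polynomial.X ^ (M + 1) : ℂ[X])) := by
  have : FreeMonoid.lift (truncMatrices M μ) =
    ((AdjoinRoot.mk (Polynomial.X ^ (M + 1) : ℂ[X])).mapMatrix.toMonoidHom).comp μ := by
    ext1 i
    simp [truncMatrices]
  rw [this]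
  rfl

theorem truncCoeff_matrixIterate (hN : 2 ≤ N)
    (μ : FreeMonoid (Fin n) →* Matrix (Fin N) (Fin N) ℂ[X]) (q : NCPoly ℂ n) (hq : q.coeff 1 = 0)
    (hμ : Represents hN μ q.zMul.pseudoInverse) (k m : ℕ) (hm : 1 ≤ m) (hmM : m ≤ M) :
    truncCoeff m (matrixIterate (truncMatrices M μ) k (firstIdx hN) (lastIdx hN)) =
      (pairingIterate n k).coeff.sum fun F c => c * (q ^ m).coeff F := by
  -- The identity has no entry at the position (1, N), because N ≥ 2.
  have h1 : matrixIterate (truncMatrices M μ) k (firstIdx hN) (lastIdx hN) =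
      (matrixIterate (truncMatrices M μ) k + 1) (firstIdx hN) (lastIdx hN) := by
    rw [Matrix.add_apply, Matrix.one_apply_ne, add_zero]
    intro h
    have := congrArg Fin.val h
    simp only [firstIdx, lastIdx] at this
    omega
  rw [h1, matrixIterate_add_one, evalAt, MonoidAlgebra.lift_apply, Finsupp.sum, Matrix.sum_apply,
    truncCoeff_sum, Finsupp.sum]
  refine Finset.sum_congr rfl fun F _ => ?_
  rw [Matrix.smul_apply, truncCoeff_smul, evalAt_truncMatrices_word, Matrix.map_apply,
    truncCoeff_mk hmM, ← hμ F, coeff_pseudoInverse_zMul q hq F hm]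

variable {A : Type*} [Ring A] [Algebra ℂ A] {τ : A →ₗ[ℂ] ℂ} {s : Fin n → A}

/-- The words in qᵐ have length at most m deg p ≤ (deg p) M, the range in which the iterate of index
(deg p) M has the right coefficients. -/
theorem moment_eq_truncCoeff [Star A] (h1 : τ 1 = 1) (hs : ∀ i, IsStandardSemicircular τ (s i))
    (hf : FreelyIndependent τ s) (p : NCPoly ℂ n) (hN : 2 ≤ N)
    (μ : FreeMonoid (Fin n) →* Matrix (Fin N) (Fin N) ℂ[X])
    (hμ : Represents hN μ p.reducedPart.zMul.pseudoInverse) {m : ℕ} (hm : 1 ≤ m) (hmM : m ≤ M) :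
    τ (p.reducedPart.evalAt s ^ m) =
      truncCoeff m (matrixIterate (truncMatrices M μ) (p.deg * M) (firstIdx hN) (lastIdx hN)) := by
  classical
  rw [truncCoeff_matrixIterate hN μ _ (by rw [coeff_reducedPart, if_pos rfl]) hμ _ m hm hmM,
    ← map_pow, map_evalAt_eq_sum h1 hs hf _ (p.deg * M)]
  intro F hF
  refine (length_le_of_coeff_pow_ne_zero _ p.deg p.length_le_deg_of_reducedPart m F hF).trans ?_
  rw [mul_comm]
  exact Nat.mul_le_mul_left _ hmM

theorem evalAt_eq_add_reducedPart (p : NCPoly ℂ n) :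
    p.evalAt s = p.constPart • 1 + p.reducedPart.evalAt s := by
  rw [reducedPart, map_sub]
  simp [evalAt]

theorem moment_eq_sum_choose (p : NCPoly ℂ n) (M : ℕ) :
    τ (p.evalAt s ^ M) = ∑ k ∈ Finset.range (M + 1), (M.choose k : ℂ) * p.constPart ^ k *
      τ (p.reducedPart.evalAt s ^ (M - k)) := by
  rw [evalAt_eq_add_reducedPart p, Commute.add_pow, map_sum]
  · refine Finset.sum_congr rfl fun k _ => ?_
    rw [smul_pow, one_pow, smul_one_mul, ← nsmul_eq_mul', smul_comm, map_smul, map_nsmul]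
    simp only [smul_eq_mul, nsmul_eq_mul]
    ring
  · exact (Commute.one_left _).smul_left _

end Correctness

/-! ### A Hoare logic with step counts. -/

namespace Machine

variable {R : Type*}

/-- The arrays of natural numbers that a program may write. -/
def Program.natWrites : Program → List ℕ
  | skip => []
  | setNat a _ _ => [a]
  | setNum _ _ _ => []
  | seq c d => c.natWrites ++ d.natWrites
  | ite _ _ c d => c.natWrites ++ d.natWrites
  | loop x _ c => x :: c.natWrites

/-- The arrays of numbers that a program may write. -/
def Program.numWrites : Program → List ℕ
  | skip => []
  | setNat _ _ _ => []
  | setNum a _ _ => [a]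
  | seq c d => c.numWrites ++ d.numWrites
  | ite _ _ c d => c.numWrites ++ d.numWrites
  | loop _ _ c => c.numWrites

/-- Two memories agree outside of some arrays. -/
structure Agree (W V : List ℕ) (s s' : Store R) : Prop where
  nat : ∀ a, a ∉ W → s'.nat a = s.nat a
  num : ∀ a, a ∉ V → s'.num a = s.num a

namespace Agree

variable {W V W' V' : List ℕ} {s s' s'' : Store R}

theorem refl (W V : List ℕ) (s : Store R) : Agree W V s s := ⟨fun _ _ => rfl, fun _ _ => rfl⟩

theorem mono (h : Agree W V s s') (hW : W ⊆ W') (hV : V ⊆ V') : Agree W' V' s s' :=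
  ⟨fun a ha => h.nat a fun h' => ha (hW h'), fun a ha => h.num a fun h' => ha (hV h')⟩

theorem trans (h : Agree W V s s') (h' : Agree W V s' s'') : Agree W V s s'' :=
  ⟨fun a ha => (h'.nat a ha).trans (h.nat a ha), fun a ha => (h'.num a ha).trans (h.num a ha)⟩

theorem setNat (h : Agree W V s s') {a : ℕ} (ha : a ∈ W) (i : List ℕ) (v : ℕ) :
    Agree W V s (s'.setNat a i v) := by
  refine ⟨fun b hb => ?_, h.num⟩
  rw [← h.nat b hb]
  funext j
  refine if_neg ?_
  rintro ⟨rfl, -⟩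
  exact hb ha

theorem setNum (h : Agree W V s s') {a : ℕ} (ha : a ∈ V) (i : List ℕ) (v : R) :
    Agree W V s (s'.setNum a i v) := by
  refine ⟨h.nat, fun b hb => ?_⟩
  rw [← h.num b hb]
  funext j
  refine if_neg ?_
  rintro ⟨rfl, -⟩
  exact hb ha

end Agree

theorem Store.setNat_nat_self (s : Store R) (a : ℕ) (i : List ℕ) (v : ℕ) :
    (s.setNat a i v).nat a i = v := if_pos ⟨rfl, rfl⟩

theorem Store.setNat_nat_of_ne (s : Store R) {a b : ℕ} (h : b ≠ a) (i : List ℕ) (v : ℕ) :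
    (s.setNat a i v).nat b = s.nat b := by
  funext j
  exact if_neg fun hj => h hj.1

theorem Store.setNum_num_self (s : Store R) (a : ℕ) (i : List ℕ) (v : R) :
    (s.setNum a i v).num a i = v := if_pos ⟨rfl, rfl⟩

theorem Store.setNum_num_of_ne (s : Store R) {a b : ℕ} (h : b ≠ a) (i : List ℕ) (v : R) :
    (s.setNum a i v).num b = s.num b := by
  funext j
  exact if_neg fun hj => h hj.1

variable [Ring R]

/-- This is the frame rule: that data survive a piece of program reduces to a membership question
about explicit lists, mostly settled by `decide`. -/
theorem agree_run (c : Program) (s : Store R) : Agree c.natWrites c.numWrites s (c.run s).1 := by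
  induction c generalizing s with
  | skip => exact Agree.refl _ _ _
  | setNat a idx e => exact (Agree.refl _ _ _).setNat (List.mem_singleton_self _) _ _
  | setNum a idx e => exact (Agree.refl _ _ _).setNum (List.mem_singleton_self _) _ _
  | seq c d hc hd =>
    exact ((hc s).mono (List.subset_append_left _ _) (List.subset_append_left _ _)).trans
      ((hd _).mono (List.subset_append_right _ _) (List.subset_append_right _ _))
  | ite e f c d hc hd =>
    rw [Program.run]
    dsimp only
    split_ifs
    · exact (hc s).mono (List.subset_append_left _ _) (List.subset_append_left _ _)
    · exact (hd s).mono (List.subset_append_right _ _) (List.subset_append_right _ _)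
  | loop x e c hc =>
    rw [Program.run]
    generalize e.eval s = k
    induction k with
    | zero => exact Agree.refl _ _ _
    | succ k ih =>
      exact (ih.setNat (List.mem_cons_self ..) _ _).trans
        ((hc _).mono (List.subset_cons_self _ _) (List.Subset.refl _))

/-- The program `c`, started in the memory `s`, takes at most `T` steps and ends in a memory that
satisfies `Q`. -/
def Runs (c : Program) (s : Store R) (T : ℕ) (Q : Store R → Prop) : Prop :=
  (c.run s).2 ≤ T ∧ Q (c.run s).1

namespace Runs

variable {c d : Program} {s : Store R} {T T' : ℕ} {P Q : Store R → Prop}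

theorem mono (h : Runs c s T P) (hT : T ≤ T')
    (hQ : ∀ s', Agree c.natWrites c.numWrites s s' → P s' → Q s') : Runs c s T' Q :=
  ⟨h.1.trans hT, hQ _ (agree_run c s) h.2⟩

theorem of_le (h : Runs c s T Q) (hT : T ≤ T') : Runs c s T' Q := ⟨h.1.trans hT, h.2⟩

theorem skip (h : Q s) : Runs Program.skip s 1 Q := ⟨le_rfl, h⟩

theorem setNat {a : ℕ} {idx : List ℕ} {e : NatExp}
    (h : Q (s.setNat a (s.index idx) (e.eval s))) :
    Runs (Program.setNat a idx e) s (1 + idx.length + e.cost) Q := ⟨le_rfl, h⟩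

theorem setNum {a : ℕ} {idx : List ℕ} {e : NumExp}
    (h : Q (s.setNum a (s.index idx) (e.eval s))) :
    Runs (Program.setNum a idx e) s (1 + idx.length + e.cost) Q := ⟨le_rfl, h⟩

theorem seq (hc : Runs c s T P)
    (hd : ∀ s', Agree c.natWrites c.numWrites s s' → P s' → Runs d s' T' Q) :
    Runs (Program.seq c d) s (T + T') Q :=
  have h := hd _ (agree_run c s) hc.2
  ⟨Nat.add_le_add hc.1 h.1, h.2⟩

theorem ite {e f : NatExp} (hc : e.eval s ≤ f.eval s → Runs c s T Q)
    (hd : f.eval s < e.eval s → Runs d s T Q) :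
    Runs (Program.ite e f c d) s (1 + e.cost + f.cost + T) Q := by
  unfold Runs
  rw [Program.run]
  dsimp only
  split_ifs with h
  · exact ⟨Nat.add_le_add_left (hc h).1 _, (hc h).2⟩
  · exact ⟨Nat.add_le_add_left (hd (not_le.1 h)).1 _, (hd (not_le.1 h)).2⟩

/-- The invariant has to survive the assignment of the counter, which is `hI`. The bound `B` on the
number of passes is separate from `E`, so that an inner loop whose length varies has a uniform cost.
-/
theorem loop {x : ℕ} {e : NatExp} (I : ℕ → Store R → Prop) {B E : ℕ} (hE : e.eval s = E)
    (hB : E ≤ B) (hI : ∀ i s' v, I i s' → I i (s'.setNat x [] v)) (h0 : I 0 s)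
    (hstep : ∀ i s', i < E → Agree (x :: c.natWrites) c.numWrites s s' →
      s'.nat x [] = i → I i s' → Runs c s' T (I (i + 1))) :
    Runs (Program.loop x e c) s (1 + e.cost + B * (T + 1)) (I E) := by
  suffices h : ∀ k ≤ E,
      let r := Nat.rec (motive := fun _ => Store R × ℕ) (s, 1 + e.cost)
        (fun i r =>
          let r' := c.run (r.1.setNat x [] i)
          (r'.1, r.2 + 1 + r'.2)) k
      Agree (x :: c.natWrites) c.numWrites s r.1 ∧ r.2 ≤ 1 + e.cost + k * (T + 1) ∧ I k r.1 by
    obtain ⟨-, h1, h2⟩ := h E le_rfl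
    unfold Runs
    rw [Program.run, hE]
    exact ⟨h1.trans (Nat.add_le_add_left (Nat.mul_le_mul_right _ hB) _), h2⟩
  intro k
  induction k with
  | zero => intro _; exact ⟨Agree.refl _ _ _, by simp, h0⟩
  | succ k ih =>
    intro hk
    obtain ⟨h1, h2, h3⟩ := ih (Nat.le_of_succ_le hk)
    have h4 := h1.setNat (List.mem_cons_self ..) [] k
    have h5 := hstep k _ hk h4 (Store.setNat_nat_self _ _ _ _) (hI _ _ _ h3)
    refine ⟨h4.trans ((agree_run c _).mono (List.subset_cons_self _ _) (List.Subset.refl _)), ?_,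
      h5.2⟩
    have h6 := h5.1
    dsimp only at h2 h6 ⊢
    rw [Nat.succ_mul]
    omega

end Runs

/-- Assign `e` to all cells `a[j, k, l]` with `j, k < N` and `l ≤ M`; the program `c` is run before
each assignment. -/
def fill (a : ℕ) (c : Program) (e : NumExp) : Program :=
  .loop 10 (.cell 5 []) (.loop 11 (.cell 5 []) (.loop 12 (.add (.cell 1 []) (.const 1))
    (.seq c (.setNum a [10, 11, 12] e))))

/-- The invariants say that the cells lexicographically before the current position hold `g` and
that all others still have their old values. The second half lets `hbody` read the old value of the
cell about to be overwritten, as an in-place update requires. -/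
theorem runs_fill {a : ℕ} {c : Program} {e : NumExp} {s : Store R} {N M K : ℕ}
    (hN0 : 1 ≤ N) (hK : 1 ≤ K)
    (hN : s.nat 5 [] = N) (hM : s.nat 1 [] = M) (hc : ∀ b ∈ [1, 5, 10, 11, 12], b ∉ c.natWrites)
    (ha : a ∉ c.numWrites) (he : e.cost ≤ 10) (g : Fin N → Fin N → ℕ → R)
    (hbody : ∀ (j k : Fin N) (l : ℕ), l ≤ M → ∀ s',
      Agree (10 :: 11 :: 12 :: c.natWrites) (a :: c.numWrites) s s' → s'.nat 10 [] = j →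
      s'.nat 11 [] = k → s'.nat 12 [] = l →
      s'.num a [(j : ℕ), (k : ℕ), l] = s.num a [(j : ℕ), (k : ℕ), l] →
      Runs c s' K fun s'' => e.eval s'' = g j k l) :
    Runs (fill a c e) s (400 * (N ^ 2 * (M + 1) * K))
      fun s' => ∀ (j k : Fin N) (l : ℕ), l ≤ M → s'.num a [(j : ℕ), (k : ℕ), l] = g j k l := by
  have hsub : ∀ b ∈ [1, 5], b ∉ 10 :: 11 :: 12 :: c.natWrites := by
    intro b hb
    have := hc b (by simp only [List.mem_cons, List.not_mem_nil] at hb ⊢; tauto)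
    simp only [List.mem_cons, List.not_mem_nil, or_false] at hb
    simp only [List.mem_cons, this, or_false]
    omega
  have h10 := hc 10 (by simp)
  have h11 := hc 11 (by simp)
  have h12 := hc 12 (by simp)
  have h1 := hsub 1 (by simp)
  have h5 := hsub 5 (by simp)
  refine (Runs.loop (B := N) (E := N) (T := 2 + N * (4 + (M + 1) * (K + (1 + 3 + 10) + 1) + 1)) (I := fun i s' => ∀ (j k : Fin N) (l : ℕ), l ≤ M →
    s'.num a [(j : ℕ), (k : ℕ), l] =
      if (j : ℕ) < i then g j k l else s.num a [(j : ℕ), (k : ℕ), l])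
    (e := .cell 5 []) hN le_rfl (fun _ _ _ h => h) (by simp) ?_).mono ?_ ?_
  · intro i s1 hi hA1 hi1 hI1
    refine (Runs.loop (B := N) (E := N) (T := 4 + (M + 1) * (K + (1 + 3 + 10) + 1)) (I := fun i' s' => ∀ (j k : Fin N) (l : ℕ), l ≤ M →
      s'.num a [(j : ℕ), (k : ℕ), l] =
        if (j : ℕ) < i ∨ (j : ℕ) = i ∧ (k : ℕ) < i' then g j k l
        else s.num a [(j : ℕ), (k : ℕ), l])
      ?_ le_rfl (fun _ _ _ h => h) (by simpa using hI1) ?_).mono le_rfl ?_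
    · change s1.nat 5 [] = N
      rw [hA1.nat 5 (by simpa [Program.natWrites] using h5), hN]
    · intro i' s2 hi' hA2 hi2 hI2
      have hA12 : Agree (10 :: 11 :: 12 :: c.natWrites) (a :: c.numWrites) s s2 := by
        refine (hA1.mono ?_ ?_).trans (hA2.mono ?_ ?_) <;>
          simp [Program.natWrites, Program.numWrites, List.subset_def] <;> tauto
      refine (Runs.loop (B := M + 1) (E := M + 1) (T := K + (1 + 3 + 10)) (I := fun i'' s' => ∀ (j k : Fin N) (l : ℕ), l ≤ M →
        s'.num a [(j : ℕ), (k : ℕ), l] =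
          if (j : ℕ) < i ∨ (j : ℕ) = i ∧ ((k : ℕ) < i' ∨ (k : ℕ) = i' ∧ l < i'') then g j k l
          else s.num a [(j : ℕ), (k : ℕ), l])
        ?_ le_rfl (fun _ _ _ h => h) (by simpa using hI2) ?_).mono le_rfl ?_
      · change s2.nat 1 [] + 1 = M + 1
        rw [hA12.nat 1 h1, hM]
      · intro i'' s3 hi'' hA3 hi3 hI3
        have hA23 : Agree (10 :: 11 :: 12 :: c.natWrites) (a :: c.numWrites) s s3 := by
          refine hA12.trans (hA3.mono ?_ ?_) <;>
            simp [Program.natWrites, Program.numWrites, List.subset_def] <;> tauto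
        have e10 : s3.nat 10 [] = i := by
          rw [hA3.nat 10 (by simpa [Program.natWrites] using h10),
            hA2.nat 10 (by simpa [Program.natWrites] using h10), hi1]
        have e11 : s3.nat 11 [] = i' := by
          rw [hA3.nat 11 (by simpa [Program.natWrites] using h11), hi2]
        refine (Runs.seq (hbody ⟨i, hi⟩ ⟨i', hi'⟩ i'' (by omega) s3 hA23 e10 e11 hi3 ?_)
          (fun s4 hA4 h4 => Runs.setNum ?_)).of_le ?_
        · rw [hI3 ⟨i, hi⟩ ⟨i', hi'⟩ i'' (by omega), if_neg]
          simp
        · intro j k l hl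
          have hidx : s4.index [10, 11, 12] = [i, i', i''] := by
            simp [Store.index, hA4.nat 10 h10, hA4.nat 11 h11, hA4.nat 12 h12, e10, e11, hi3]
          rw [hidx, h4]
          by_cases hjkl : (j : ℕ) = i ∧ (k : ℕ) = i' ∧ l = i''
          · obtain ⟨rfl, rfl, rfl⟩ := hjkl
            rw [Store.setNum_num_self, if_pos (by omega)]
          · have : (s4.setNum a [i, i', i''] (g ⟨i, hi⟩ ⟨i', hi'⟩ i'')).num a [(j : ℕ), (k : ℕ), l] =
                s4.num a [(j : ℕ), (k : ℕ), l] := if_neg (by simpa using hjkl)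
            rw [this, hA4.num a ha, hI3 j k l hl]
            refine if_congr ?_ rfl rfl
            omega
        · simp only [List.length_cons, List.length_nil]
          omega
      · intro s' _ h j k l hl
        rw [h j k l hl]
        refine if_congr ?_ rfl rfl
        omega
    · intro s' _ h j k l hl
      rw [h j k l hl]
      refine if_congr ?_ rfl rfl
      have := k.2
      omega
  · simp only [NatExp.cost, List.length_nil]
    -- The loop overheads are absorbed from the inside outwards; this uses that the products
    -- involved are at least 1.
    have e1 : 4 + (M + 1) * (K + (1 + 3 + 10) + 1) + 1 ≤ 21 * ((M + 1) * K) := by nlinarith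
    have e2 : 2 + N * (4 + (M + 1) * (K + (1 + 3 + 10) + 1) + 1) + 1 ≤ 25 * (N * ((M + 1) * K)) := by
      have : 1 ≤ N * ((M + 1) * K) := Nat.mul_pos hN0 (Nat.mul_pos (by omega) hK)
      have := Nat.mul_le_mul_left N e1
      nlinarith
    have := Nat.mul_le_mul_left N e2
    have : 1 ≤ N * (N * ((M + 1) * K)) :=
      Nat.mul_pos hN0 (Nat.mul_pos hN0 (Nat.mul_pos (by omega) hK))
    nlinarith
  · intro s' _ h j k l hl
    rw [h j k l hl, if_pos j.2]

/-- Add `∑ A * B` to the number `9`, where `A` may use the indices `13` and `14` and `B` may use the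
indices `13` and `15`. -/
def mulAcc (A B : NumExp) : Program :=
  .loop 13 (.cell 5 []) (.loop 14 (.add (.cell 12 []) (.const 1))
    (.seq (.setNat 15 [] (.sub (.cell 12 []) (.cell 14 [])))
      (.setNum 9 [] (.add (.cell 9 []) (.mul A B)))))

/-- The sum over `r` is the matrix product and the sum over `t` the Cauchy product of truncated
polynomials: one coefficient of one entry of a product is accumulated. The truncated subtraction l -
t is exact, since t ≤ l. -/
theorem runs_mulAcc {A B : NumExp} {s : Store R} {N M l : ℕ} (hN0 : 1 ≤ N) (hN : s.nat 5 [] = N)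
    (hl : s.nat 12 [] = l) (hlM : l ≤ M) (fA fB : Fin N → ℕ → R) (hA : A.cost ≤ 10)
    (hB : B.cost ≤ 10)
    (hfA : ∀ (r : Fin N) (t : ℕ), t ≤ l → ∀ s', Agree [13, 14, 15] [9] s s' → s'.nat 13 [] = r →
      s'.nat 14 [] = t → A.eval s' = fA r t)
    (hfB : ∀ (r : Fin N) (t : ℕ), t ≤ l → ∀ s', Agree [13, 14, 15] [9] s s' → s'.nat 13 [] = r →
      s'.nat 15 [] = t → B.eval s' = fB r t) :
    Runs (mulAcc A B) s (100 * (N * (M + 1))) fun s' => s'.num 9 [] =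
      s.num 9 [] + ∑ r, ∑ t ∈ Finset.range (l + 1), fA r t * fB r (l - t) := by
  refine (Runs.loop (B := N) (E := N) (T := 4 + (M + 1) * (30 + 1)) (I := fun i s' => s'.num 9 [] =
    s.num 9 [] + ∑ r ∈ Finset.range i, if h : r < N then
      ∑ t ∈ Finset.range (l + 1), fA ⟨r, h⟩ t * fB ⟨r, h⟩ (l - t) else 0)
    (e := .cell 5 []) hN le_rfl (fun _ _ _ h => h) (by simp) ?_).mono ?_ ?_
  · intro i s1 hi hA1 hi1 hI1
    refine (Runs.loop (B := M + 1) (E := l + 1) (T := 30) (I := fun i' s' => s'.num 9 [] =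
      s1.num 9 [] + ∑ t ∈ Finset.range i', fA ⟨i, hi⟩ t * fB ⟨i, hi⟩ (l - t))
      ?_ (by omega) (fun _ _ _ h => h) (by simp) ?_).mono le_rfl ?_
    · change s1.nat 12 [] + 1 = l + 1
      rw [hA1.nat 12 (by simp [Program.natWrites]), hl]
    · intro i' s2 hi' hA2 hi2 hI2
      refine (Runs.seq (P := fun s' => s'.nat 15 [] = l - i' ∧ s'.num = s2.num) (Runs.setNat ?_)
        (fun s3 hA3 h3 => Runs.setNum ?_)).of_le ?_
      · refine ⟨?_, rfl⟩
        have : s2.nat 12 [] = l := by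
          rw [hA2.nat 12 (by simp [Program.natWrites]), hA1.nat 12 (by simp [Program.natWrites]), hl]
        rw [← this, ← hi2]
        exact Store.setNat_nat_self _ _ _ _
      · have hA13 : Agree [13, 14, 15] [9] s s3 := by
          refine ((hA1.mono ?_ ?_).trans (hA2.mono ?_ ?_)).trans (hA3.mono ?_ ?_) <;>
            simp [Program.natWrites, Program.numWrites]
        have h13 : s3.nat 13 [] = i := by
          rw [hA3.nat 13 (by simp [Program.natWrites]), hA2.nat 13 (by simp [Program.natWrites]), hi1]
        have h14 : s3.nat 14 [] = i' := by
          rw [hA3.nat 14 (by simp [Program.natWrites]), hi2]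
        refine (Store.setNum_num_self _ _ _ _).trans ?_
        change s3.num 9 [] + A.eval s3 * B.eval s3 = _
        rw [hfA ⟨i, hi⟩ i' (by omega) s3 hA13 h13 h14,
          hfB ⟨i, hi⟩ (l - i') (by omega) s3 hA13 h13 h3.1, h3.2, hI2, Finset.sum_range_succ,
          add_assoc]
      · simp only [NatExp.cost, NumExp.cost, List.length_nil]
        omega
    · intro s' _ h
      rw [h, hI1, Finset.sum_range_succ _ i, dif_pos hi, add_assoc]
  · simp only [NatExp.cost, List.length_nil]
    have : 1 ≤ N * (M + 1) := Nat.mul_pos hN0 (by omega)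
    nlinarith
  · intro s' _ h
    rw [h, Finset.sum_range]
    simp

end Machine

/-! ### The program for the matrix iteration. -/

namespace Machine

section Iteration

variable {n N M d : ℕ}

/-- The array `a` of numbers holds a matrix. -/
def HoldsAt (a : ℕ) (X : Matrix (Fin N) (Fin N) (TruncPoly M)) (s : Store ℂ) : Prop :=
  ∀ (j k : Fin N) (l : ℕ), l ≤ M → s.num a [(j : ℕ), (k : ℕ), l] = truncCoeff l (X j k)

/-- The memory holds the data that the iteration reads. -/
structure HoldsData (d : ℕ) (μ : Fin n → Matrix (Fin N) (Fin N) (TruncPoly M)) (s : Store ℂ) :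
    Prop where
  vars : s.nat 0 [] = n
  order : s.nat 1 [] = M
  size : s.nat 5 [] = N
  degree : s.nat 6 [] = d
  matrices : ∀ (i : Fin n) (j k : Fin N) (l : ℕ), l ≤ M →
    s.num 2 [(i : ℕ), (j : ℕ), (k : ℕ), l] = truncCoeff l (μ i j k)

theorem HoldsAt.of_agree {a : ℕ} {X : Matrix (Fin N) (Fin N) (TruncPoly M)} {s s' : Store ℂ}
    {W V : List ℕ} (h : HoldsAt a X s) (hA : Agree W V s s') (ha : a ∉ V) : HoldsAt a X s' := by
  intro j k l hl
  rw [hA.num a ha]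
  exact h j k l hl

theorem HoldsData.of_agree {μ : Fin n → Matrix (Fin N) (Fin N) (TruncPoly M)} {s s' : Store ℂ}
    {W V : List ℕ} (h : HoldsData d μ s) (hA : Agree W V s s') (hW : ∀ a ∈ [0, 1, 5, 6], a ∉ W)
    (hV : 2 ∉ V) : HoldsData d μ s' where
  vars := by rw [hA.nat 0 (hW 0 (by simp))]; exact h.vars
  order := by rw [hA.nat 1 (hW 1 (by simp))]; exact h.order
  size := by rw [hA.nat 5 (hW 5 (by simp))]; exact h.size
  degree := by rw [hA.nat 6 (hW 6 (by simp))]; exact h.degree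
  matrices := by rw [hA.num 2 hV]; exact h.matrices

/-- Set the array `a` to the zero matrix. -/
def zeroMatrix (a : ℕ) : Program := fill a .skip .zero

/-- Copy the matrix `a` to the matrix `b`. -/
def copyMatrix (a b : ℕ) : Program := fill b .skip (.cell a [10, 11, 12])

/-- Set the matrix `6` to the sum of the matrix `3` and the identity. -/
def addIdentity : Program :=
  fill 6 (.ite (.add (.add (.sub (.cell 10 []) (.cell 11 [])) (.sub (.cell 11 []) (.cell 10 [])))
    (.cell 12 [])) (.const 0) (.setNum 12 [] .one) (.setNum 12 [] .zero))
    (.add (.cell 3 [10, 11, 12]) (.cell 12 []))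

/-- Set the matrix `8` to the product of the matrix `μ i`, with `i` in the scalar `16`, and the
matrix `6`. -/
def mulLeft : Program :=
  fill 8 (.seq (.setNum 9 [] .zero) (mulAcc (.cell 2 [16, 10, 13, 14]) (.cell 6 [13, 11, 15])))
    (.cell 9 [])

/-- Add the square of the matrix `8` to the matrix `7`. -/
def addSquare : Program :=
  fill 7 (.seq (.setNum 9 [] (.cell 7 [10, 11, 12]))
    (mulAcc (.cell 8 [10, 13, 14]) (.cell 8 [13, 11, 15]))) (.cell 9 [])

/-- One step of the iteration, on the matrix `3`. -/
def iterationStep : Program :=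
  .seq addIdentity (.seq (zeroMatrix 7) (.seq (.loop 16 (.cell 0 []) (.seq mulLeft addSquare))
    (copyMatrix 7 3)))

/-- The iteration, on the matrix `3`. -/
def iteration : Program :=
  .seq (zeroMatrix 3) (.loop 17 (.cell 6 []) (.loop 18 (.cell 1 []) iterationStep))

variable {μ : Fin n → Matrix (Fin N) (Fin N) (TruncPoly M)} {s : Store ℂ}

theorem runs_zeroMatrix (hN0 : 1 ≤ N) (hs : HoldsData d μ s) (a : ℕ) :
    Runs (zeroMatrix a) s (400 * (N ^ 2 * (M + 1)))
      (HoldsAt a (0 : Matrix (Fin N) (Fin N) (TruncPoly M))) := by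
  have h := runs_fill (a := a) (c := .skip) (e := .zero) (K := 1) hN0 le_rfl hs.size hs.order
    (by decide) (by simp [Program.numWrites]) (by decide) (fun _ _ _ => 0)
    (fun j k l hl s' _ _ _ _ _ => Runs.skip rfl)
  rw [mul_one] at h
  refine h.mono le_rfl fun s' _ h j k l hl => ?_
  rw [h j k l hl, Matrix.zero_apply, truncCoeff_zero]

theorem runs_copyMatrix (hN0 : 1 ≤ N) (hs : HoldsData d μ s) {a b : ℕ} (hab : a ≠ b)
    {X : Matrix (Fin N) (Fin N) (TruncPoly M)} (hX : HoldsAt a X s) :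
    Runs (copyMatrix a b) s (400 * (N ^ 2 * (M + 1))) (HoldsAt b X) := by
  have h := runs_fill (a := b) (c := .skip) (e := .cell a [10, 11, 12]) (K := 1) hN0 le_rfl hs.size
    hs.order (by decide) (by simp [Program.numWrites]) (by simp [NumExp.cost]) (fun j k l => truncCoeff l (X j k))
    (fun j k l hl s' hA h1 h2 h3 _ => Runs.skip ?_)
  · rw [mul_one] at h
    exact h
  · simp only [NumExp.eval, Store.index, List.map_cons, List.map_nil, h1, h2, h3]
    rw [hA.num a (by simpa [Program.numWrites] using hab)]
    exact hX j k l hl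

theorem runs_addIdentity (hN0 : 1 ≤ N) (hs : HoldsData d μ s)
    {X : Matrix (Fin N) (Fin N) (TruncPoly M)} (hX : HoldsAt 3 X s) :
    Runs addIdentity s (400 * (N ^ 2 * (M + 1) * 20)) (HoldsAt 6 (X + 1)) := by
  refine runs_fill (K := 20) hN0 (by omega) hs.size hs.order (by decide) (by decide) (by decide) _
    (fun j k l hl s' hA h1 h2 h3 _ => ?_)
  have h3X : s'.num 3 = s.num 3 := hA.num 3 (by decide)
  -- With truncated subtraction, (j - k) + (k - j) + l ≤ 0 means j = k and l = 0, the only place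
  -- where the identity has a nonzero coefficient.
  refine (Runs.ite (T := 2) (fun h => Runs.setNum ?_) (fun h => Runs.setNum ?_)).of_le (by decide)
  · simp only [NatExp.eval, Store.index, List.map_nil, h1, h2, h3] at h
    have hjk : j = k := Fin.ext (by omega)
    have hl0 : l = 0 := by omega
    simp only [NumExp.eval, Store.index, Store.setNum, List.map_cons, List.map_nil, h1, h2, h3]
    rw [if_neg (by simp), if_pos (by simp), h3X, hX j k l hl, Matrix.add_apply, truncCoeff_add, hjk,
      Matrix.one_apply_eq, truncCoeff_one hl, if_pos hl0]
  · simp only [NatExp.eval, Store.index, List.map_nil, h1, h2, h3] at h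
    simp only [NumExp.eval, Store.index, Store.setNum, List.map_cons, List.map_nil, h1, h2, h3]
    rw [if_neg (by simp), if_pos (by simp), h3X, hX j k l hl, Matrix.add_apply, truncCoeff_add]
    congr 1
    by_cases hjk : j = k
    · subst hjk
      rw [Matrix.one_apply_eq, truncCoeff_one hl, if_neg (by omega)]
    · rw [Matrix.one_apply_ne hjk, truncCoeff_zero]

theorem truncCoeff_matrix_mul {l : ℕ} (hl : l ≤ M) (X Y : Matrix (Fin N) (Fin N) (TruncPoly M))
    (j k : Fin N) : truncCoeff l ((X * Y) j k) =
      ∑ r, ∑ t ∈ Finset.range (l + 1), truncCoeff t (X j r) * truncCoeff (l - t) (Y r k) := by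
  rw [Matrix.mul_apply, truncCoeff_sum]
  exact Finset.sum_congr rfl fun r _ => truncCoeff_mul hl _ _

theorem runs_mulLeft (hN0 : 1 ≤ N) (hs : HoldsData d μ s)
    {X : Matrix (Fin N) (Fin N) (TruncPoly M)} (hX : HoldsAt 6 X s) (i : Fin n)
    (hi : s.nat 16 [] = i) :
    Runs mulLeft s (400 * (N ^ 2 * (M + 1) * (2 + 100 * (N * (M + 1))))) (HoldsAt 8 (μ i * X)) := by
  refine runs_fill (K := 2 + 100 * (N * (M + 1))) hN0 (by omega) hs.size hs.order (by decide)
    (by decide) (by decide) _ (fun j k l hl s' hA h1 h2 h3 _ => ?_)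
  refine Runs.seq (P := fun s'' => s''.num 9 [] = 0)
    (Runs.setNum (Store.setNum_num_self _ _ _ _)) (fun s'' hA' h0 => ?_)
  have hA2 := hA.trans (hA'.mono (List.nil_subset _) (by decide))
  have h1' : s''.nat 10 [] = j := by rw [hA'.nat 10 (by decide), h1]
  have h2' : s''.nat 11 [] = k := by rw [hA'.nat 11 (by decide), h2]
  have h3' : s''.nat 12 [] = l := by rw [hA'.nat 12 (by decide), h3]
  have hi' : s''.nat 16 [] = i := by rw [hA2.nat 16 (by decide), hi]
  have h2X : s''.num 2 = s.num 2 := hA2.num 2 (by decide)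
  have h6X : s''.num 6 = s.num 6 := hA2.num 6 (by decide)
  have h5 : s''.nat 5 [] = N := by rw [hA2.nat 5 (by decide), hs.size]
  refine (runs_mulAcc (M := M) hN0 h5 h3' hl (fun r t => truncCoeff t (μ i j r))
    (fun r t => truncCoeff t (X r k)) (by decide) (by decide) ?_ ?_).mono le_rfl ?_
  · intro r t ht q hq hr hqt
    simp only [NumExp.eval, Store.index, List.map_cons, List.map_nil, hr, hqt,
      hq.nat 16 (by decide), hi', hq.nat 10 (by decide), h1', hq.num 2 (by decide), h2X]
    exact hs.matrices i j r t (by omega)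
  · intro r t ht q hq hr hqt
    simp only [NumExp.eval, Store.index, List.map_cons, List.map_nil, hr, hqt,
      hq.nat 11 (by decide), h2', hq.num 6 (by decide), h6X]
    exact hX r k t (by omega)
  · intro q _ hq
    rw [h0, zero_add] at hq
    rw [truncCoeff_matrix_mul hl]
    exact hq

/-- The accumulator starts from the old entry of the array `7`, and the product reads only the array
`8`, so the sum can be updated in place. -/
theorem runs_addSquare (hN0 : 1 ≤ N) (hs : HoldsData d μ s)
    {X Y : Matrix (Fin N) (Fin N) (TruncPoly M)} (hX : HoldsAt 8 X s) (hY : HoldsAt 7 Y s) :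
    Runs addSquare s (400 * (N ^ 2 * (M + 1) * (5 + 100 * (N * (M + 1)))))
      (HoldsAt 7 (Y + X ^ 2)) := by
  refine runs_fill (K := 5 + 100 * (N * (M + 1))) hN0 (by omega) hs.size hs.order (by decide)
    (by decide) (by decide) _ (fun j k l hl s' hA h1 h2 h3 h7 => ?_)
  refine Runs.seq (P := fun s'' => s''.num 9 [] = truncCoeff l (Y j k))
    (Runs.setNum ?_) (fun s'' hA' h0 => ?_)
  · refine (Store.setNum_num_self _ _ _ _).trans ?_
    simp only [NumExp.eval, Store.index, List.map_cons, List.map_nil, h1, h2, h3, h7]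
    exact hY j k l hl
  have hA2 := hA.trans (hA'.mono (List.nil_subset _) (by decide))
  have h1' : s''.nat 10 [] = j := by rw [hA'.nat 10 (by decide), h1]
  have h2' : s''.nat 11 [] = k := by rw [hA'.nat 11 (by decide), h2]
  have h3' : s''.nat 12 [] = l := by rw [hA'.nat 12 (by decide), h3]
  have h8X : s''.num 8 = s.num 8 := hA2.num 8 (by decide)
  have h5 : s''.nat 5 [] = N := by rw [hA2.nat 5 (by decide), hs.size]
  refine (runs_mulAcc (M := M) hN0 h5 h3' hl (fun r t => truncCoeff t (X j r))
    (fun r t => truncCoeff t (X r k)) (by decide) (by decide) ?_ ?_).mono le_rfl ?_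
  · intro r t ht q hq hr hqt
    simp only [NumExp.eval, Store.index, List.map_cons, List.map_nil, hr, hqt,
      hq.nat 10 (by decide), h1', hq.num 8 (by decide), h8X]
    exact hX j r t (by omega)
  · intro r t ht q hq hr hqt
    simp only [NumExp.eval, Store.index, List.map_cons, List.map_nil, hr, hqt,
      hq.nat 11 (by decide), h2', hq.num 8 (by decide), h8X]
    exact hX r k t (by omega)
  · intro q _ hq
    rw [h0] at hq
    rw [Matrix.add_apply, truncCoeff_add, pow_two, truncCoeff_matrix_mul hl]
    exact hq

/-- Each variable costs two matrix products, of order N³ (M + 1)² steps. The factor n + 1 instead of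
n pays for the work outside the loop over the variables. -/
theorem runs_iterationStep (hN0 : 1 ≤ N) (hs : HoldsData d μ s) {k : ℕ}
    (hX : HoldsAt 3 (matrixIterate μ k) s) :
    Runs iterationStep s (200000 * ((n + 1) * (N ^ 3 * (M + 1) ^ 2)))
      (HoldsAt 3 (matrixIterate μ (k + 1))) := by
  refine (Runs.seq (runs_addIdentity hN0 hs hX) fun s1 hA1 h6 => Runs.seq
    (runs_zeroMatrix hN0 (hs.of_agree hA1 (by decide) (by decide)) 7) fun s2 hA2 h7 => Runs.seq
    (P := HoldsAt 7 (matrixIterate μ (k + 1)))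
    (T := 2 + n * (400 * (N ^ 2 * (M + 1) * (2 + 100 * (N * (M + 1)))) +
      400 * (N ^ 2 * (M + 1) * (5 + 100 * (N * (M + 1)))) + 1)) ?_ fun s3 hA3 h7' =>
    runs_copyMatrix (a := 7) (b := 3) hN0 (((hs.of_agree hA1 (by decide) (by decide)).of_agree hA2
      (by decide) (by decide)).of_agree hA3 (by decide) (by decide)) (by decide) h7').of_le ?_
  · have hs2 := (hs.of_agree hA1 (by decide) (by decide)).of_agree hA2 (by decide) (by decide)
    have h6' := h6.of_agree hA2 (by decide)
    refine (Runs.loop (B := n) (E := n) (T := 400 * (N ^ 2 * (M + 1) * (2 + 100 * (N * (M + 1)))) +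
      400 * (N ^ 2 * (M + 1) * (5 + 100 * (N * (M + 1))))) (e := .cell 0 []) (fun i s' => HoldsAt 7
      (∑ r ∈ Finset.range i, if h : r < n then (μ ⟨r, h⟩ * (matrixIterate μ k + 1)) ^ 2 else 0) s')
      hs2.vars le_rfl (fun _ _ _ h => h) (by simpa using h7) ?_).mono le_rfl ?_
    · intro i s4 hi hA4 hi4 hI4
      have hs4 := hs2.of_agree hA4 (by decide) (by decide)
      refine Runs.seq (runs_mulLeft hN0 hs4 (h6'.of_agree hA4 (by decide)) ⟨i, hi⟩ hi4)
        fun s5 hA5 h8 => ?_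
      have := runs_addSquare hN0 (hs4.of_agree hA5 (by decide) (by decide)) h8
        (hI4.of_agree hA5 (by decide))
      rwa [Finset.sum_range_succ, dif_pos hi]
    · intro s' _ h
      rw [Finset.sum_range] at h
      simpa [matrixIterate] using h
  · have e1 : N ^ 2 * (M + 1) ≤ N ^ 3 * (M + 1) ^ 2 :=
      Nat.mul_le_mul (Nat.pow_le_pow_right hN0 (by omega)) (Nat.le_self_pow (by omega) _)
    have e2 : N ^ 2 * (M + 1) * (N * (M + 1)) = N ^ 3 * (M + 1) ^ 2 := by ring
    have e3 : 1 ≤ N ^ 3 * (M + 1) ^ 2 := Nat.mul_pos (Nat.pow_pos hN0) (Nat.pow_pos (by omega))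
    have e4 : n * (N ^ 2 * (M + 1)) ≤ n * (N ^ 3 * (M + 1) ^ 2) := Nat.mul_le_mul_left _ e1
    have e5 : n * 1 ≤ n * (N ^ 3 * (M + 1) ^ 2) := Nat.mul_le_mul_left _ e3
    generalize N ^ 3 * (M + 1) ^ 2 = X at *
    generalize N ^ 2 * (M + 1) = Y at *
    generalize N * (M + 1) = Z at *
    have e6 : n * (Y * Z) = n * X := by rw [e2]
    nlinarith

/-- The machine cannot multiply natural numbers, so the d * M iterations are two nested loops. -/
theorem runs_iteration (hN0 : 1 ≤ N) (hM0 : 1 ≤ M) (hs : HoldsData d μ s) :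
    Runs iteration s (300000 * ((d + 1) * ((n + 1) * (N ^ 3 * (M + 1) ^ 3))))
      (HoldsAt 3 (matrixIterate μ (d * M))) := by
  refine (Runs.seq (runs_zeroMatrix hN0 hs 3) fun s1 hA1 h3 => Runs.loop (B := d) (E := d)
    (T := 2 + M * (200000 * ((n + 1) * (N ^ 3 * (M + 1) ^ 2)) + 1)) (e := .cell 6 [])
    (fun i s' => HoldsAt 3 (matrixIterate μ (i * M)) s')
    (hs.of_agree hA1 (by decide) (by decide)).degree le_rfl (fun _ _ _ h => h) ?_ ?_).of_le ?_
  · rw [Nat.zero_mul]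
    exact h3
  · intro i s2 hi hA2 _ hI2
    have hs2 := (hs.of_agree hA1 (by decide) (by decide)).of_agree hA2 (by decide) (by decide)
    rw [Nat.succ_mul i M]
    refine Runs.loop (B := M) (E := M) (T := 200000 * ((n + 1) * (N ^ 3 * (M + 1) ^ 2)))
      (e := .cell 1 []) (fun i' s' => HoldsAt 3 (matrixIterate μ (i * M + i')) s')
      hs2.order le_rfl (fun _ _ _ h => h) hI2 ?_
    intro i' s3 _ hA3 _ hI3
    exact runs_iterationStep hN0 (hs2.of_agree hA3 (by decide) (by decide)) hI3
  · have e1 : N ^ 2 * (M + 1) ≤ (n + 1) * (N ^ 3 * (M + 1) ^ 3) := by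
      refine (Nat.mul_le_mul (Nat.pow_le_pow_right hN0 (by omega))
        (Nat.le_self_pow (by omega) _)).trans (Nat.le_mul_of_pos_left _ (by omega))
    have e2 : M * ((n + 1) * (N ^ 3 * (M + 1) ^ 2)) ≤ (n + 1) * (N ^ 3 * (M + 1) ^ 3) :=
      calc _ ≤ (M + 1) * ((n + 1) * (N ^ 3 * (M + 1) ^ 2)) := Nat.mul_le_mul_right _ (by omega)
        _ = _ := by ring
    have e3 : M ≤ (n + 1) * (N ^ 3 * (M + 1) ^ 3) :=
      calc M ≤ 1 * (1 * (M + 1) ^ 3) := by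
            rw [one_mul, one_mul]; exact (Nat.le_succ M).trans (Nat.le_self_pow (by omega) _)
        _ ≤ _ := Nat.mul_le_mul (by omega) (Nat.mul_le_mul_right _ (Nat.pow_pos hN0))
    simp only [NatExp.cost, List.length_nil]
    generalize (n + 1) * (N ^ 3 * (M + 1) ^ 3) = X at *
    generalize (n + 1) * (N ^ 3 * (M + 1) ^ 2) = Y at *
    generalize N ^ 2 * (M + 1) = Z at *
    have e4 := Nat.mul_le_mul_left d e2
    have e5 := Nat.mul_le_mul_left d e3
    have e6 := Nat.mul_le_mul_left d (hM0.trans e3)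
    nlinarith

end Iteration

/-! ### Reading off the moments and the binomial step. -/

section Moments

variable {n N M d : ℕ}

/-- The table `t j m` of the mixed moments `τ (p ^ j * q ^ m)`, computed from its row `j = 0`. -/
def momentTable {R : Type*} [Semiring R] (c : R) (t : ℕ → R) : ℕ → ℕ → R
  | 0, m => t m
  | j + 1, m => c * momentTable c t j m + momentTable c t j (m + 1)

/-- Read the moments off the matrix `3`. -/
def readMoments : Program :=
  .seq (.setNat 19 [] (.sub (.cell 5 []) (.const 1))) (.seq (.setNat 20 [] (.const 0))
    (.seq (.loop 12 (.add (.cell 1 []) (.const 1))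
      (.seq (.setNum 4 [12] (.cell 3 [20, 19, 12])) (.setNum 11 [12] (.cell 3 [20, 19, 12]))))
      (.setNum 11 [20] .one)))

/-- Compute the table of mixed moments. -/
def computeTable : Program :=
  .seq (.loop 13 (.cell 1 []) (.loop 14 (.sub (.cell 1 []) (.cell 13 []))
    (.seq (.setNat 15 [] (.add (.cell 14 []) (.const 1)))
      (.setNum 11 [14] (.add (.mul (.cell 1 []) (.cell 11 [14])) (.cell 11 [15]))))))
    (.setNum 5 [] (.cell 11 [20]))

variable {s : Store ℂ}

/-- The matrix entry gives the moments for m ≥ 1 only. The cell of index 0 in the array `11` is set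
to 1 = τ(q⁰), since this array becomes row 0 of the moment table. -/
theorem runs_readMoments (hM : s.nat 1 [] = M) :
    Runs readMoments s (100 * (M + 1)) fun s' => s'.nat 20 [] = 0 ∧
      ∀ m ≤ M, s'.num 4 [m] = s.num 3 [0, s.nat 5 [] - 1, m] ∧
        s'.num 11 [m] = if m = 0 then 1 else s.num 3 [0, s.nat 5 [] - 1, m] := by
  refine (Runs.seq (P := fun s' => s'.nat 19 [] = s.nat 5 [] - 1) (Runs.setNat
    (Store.setNat_nat_self _ _ _ _)) fun s1 hA1 h1 => Runs.seq
    (P := fun s' => s'.nat 20 [] = 0) (Runs.setNat (Store.setNat_nat_self _ _ _ _)) fun s2 hA2 h2 =>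
    Runs.seq (P := fun s' => ∀ m < M + 1, s'.num 4 [m] = s.num 3 [0, s.nat 5 [] - 1, m] ∧
      s'.num 11 [m] = s.num 3 [0, s.nat 5 [] - 1, m]) (T := 4 + (M + 1) * (12 + 1)) ?_
      fun s3 hA3 h3 => Runs.setNum ?_).of_le ?_
  · refine Runs.loop (B := M + 1) (E := M + 1) (fun i s' => ∀ m < i,
      s'.num 4 [m] = s.num 3 [0, s.nat 5 [] - 1, m] ∧
      s'.num 11 [m] = s.num 3 [0, s.nat 5 [] - 1, m]) ?_ le_rfl (fun _ _ _ h => h) (by simp) ?_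
    · change s2.nat 1 [] + 1 = M + 1
      rw [hA2.nat 1 (by decide), hA1.nat 1 (by decide), hM]
    · intro i s4 hi hA4 hi4 hI4
      have h19 : s4.nat 19 [] = s.nat 5 [] - 1 := by
        rw [hA4.nat 19 (by decide), hA2.nat 19 (by decide), h1]
      have h20 : s4.nat 20 [] = 0 := by rw [hA4.nat 20 (by decide), h2]
      have h3 : s4.num 3 = s.num 3 := by
        rw [hA4.num 3 (by decide), hA2.num 3 (by decide), hA1.num 3 (by decide)]
      refine Runs.seq (P := fun s' => s' = s4.setNum 4 [i] (s.num 3 [0, s.nat 5 [] - 1, i]))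
        (Runs.setNum ?_) fun s5 hA5 h5 => Runs.setNum ?_
      · simp [Store.index, NumExp.eval, h19, h20, hi4, h3]
      · subst h5
        intro m hm
        have e1 : ∀ v w, (s4.setNum 4 [i] v).num 3 w = s.num 3 w := fun v w => by
          rw [Store.setNum_num_of_ne _ (by decide), h3]
        have e2 : ∀ v, (s4.setNum 4 [i] v).nat = s4.nat := fun _ => rfl
        simp only [Store.index, NumExp.eval, List.map_cons, List.map_nil, e2, h19, h20, hi4, e1]
        by_cases hmi : m = i
        · subst hmi
          rw [Store.setNum_num_of_ne _ (by decide), Store.setNum_num_self, Store.setNum_num_self]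
          exact ⟨rfl, rfl⟩
        · have := hI4 m (by omega)
          simpa [Store.setNum, hmi] using this
  · have h20 : s3.nat 20 [] = 0 := by rw [hA3.nat 20 (by decide), h2]
    refine ⟨h20, fun m hm => ?_⟩
    have := h3 m (by omega)
    rw [Store.setNum_num_of_ne _ (by decide)]
    refine ⟨this.1, ?_⟩
    have hidx : s3.index [20] = [0] := by simp [Store.index, h20]
    rw [hidx]
    split_ifs with h0
    · subst h0
      exact Store.setNum_num_self _ _ _ _
    · simpa [Store.setNum, h0] using this.2
  · simp only [NatExp.cost, NumExp.cost, List.length_nil, List.length_cons]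
    omega

/-- A single array holds the current row. Updating it in increasing order of m is safe, because the
new entry m needs only the old entries m and m + 1. Row j is maintained for m ≤ M - j, which just
suffices for the entry 0 of row M. -/
theorem runs_computeTable (hM : s.nat 1 [] = M) (h20 : s.nat 20 [] = 0) (t : ℕ → ℂ)
    (ht : ∀ m ≤ M, s.num 11 [m] = t m) :
    Runs computeTable s (100 * (M + 1) ^ 2) fun s' =>
      s'.num 5 [] = momentTable (s.num 1 []) t M 0 := by
  refine (Runs.seq (P := fun s' => ∀ m, m + M ≤ M →
    s'.num 11 [m] = momentTable (s.num 1 []) t M m) (T := 2 + M * (4 + M * 20 + 1)) ?_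
    fun s1 hA1 h1 => Runs.setNum ?_).of_le ?_
  · refine Runs.loop (B := M) (E := M) (e := .cell 1 []) (fun j s' => ∀ m, m + j ≤ M →
      s'.num 11 [m] = momentTable (s.num 1 []) t j m) hM le_rfl (fun _ _ _ h => h) ht ?_
    intro j s1 hj hA1 hj1 hI1
    have hM1 : s1.nat 1 [] = M := by rw [hA1.nat 1 (by decide), hM]
    refine (Runs.loop (B := M) (E := M - j) (T := 19) (fun i s' => ∀ m, m + j ≤ M →
      s'.num 11 [m] = if m < i then momentTable (s.num 1 []) t (j + 1) m
        else momentTable (s.num 1 []) t j m) ?_ (by omega) (fun _ _ _ h => h)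
      (by simpa using hI1) ?_).mono le_rfl ?_
    · simp [NatExp.eval, Store.index, hM1, hj1]
    · intro i s2 hi hA2 hi2 hI2
      refine (Runs.seq (P := fun s' => s'.nat 15 [] = i + 1 ∧ s'.nat 14 [] = i ∧ s'.num = s2.num)
        (Runs.setNat ⟨?_, ?_, rfl⟩) fun s3 hA3 h3 => Runs.setNum ?_).of_le ?_
      · refine (Store.setNat_nat_self _ _ _ _).trans ?_
        simp [NatExp.eval, Store.index, hi2]
      · rw [Store.setNat_nat_of_ne _ (by decide), hi2]
      · intro m hm
        have hc : s2.num 1 = s.num 1 := by rw [hA2.num 1 (by decide), hA1.num 1 (by decide)]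
        simp only [Store.index, NumExp.eval, List.map_cons, List.map_nil, h3.1, h3.2.1, h3.2.2, hc]
        by_cases hmi : m = i
        · subst hmi
          rw [Store.setNum_num_self, if_pos (by omega), momentTable, hI2 m hm,
            hI2 (m + 1) (by omega), if_neg (by omega), if_neg (by omega)]
        · have h5 : ∀ v, (s3.setNum 11 [i] v).num 11 [m] = s3.num 11 [m] :=
            fun v => if_neg (by simpa using hmi)
          rw [h5, h3.2.2, hI2 m hm]
          refine if_congr ?_ rfl rfl
          omega
      · decide
    · intro s2 _ h m hm
      rw [h m (by omega), if_pos (by omega)]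
  · refine (Store.setNum_num_self _ _ _ _).trans ?_
    have : s1.nat 20 [] = 0 := by rw [hA1.nat 20 (by decide), h20]
    simp only [NumExp.eval, Store.index, List.map_cons, List.map_nil, this]
    exact h1 0 (by omega)
  · simp only [NumExp.cost, List.length_nil, List.length_cons]
    nlinarith

/-- The iteration and the computation of the moments. -/
def iterationAndMoments : Program := .seq iteration (.seq readMoments computeTable)

theorem runs_iterationAndMoments {μ : Fin n → Matrix (Fin N) (Fin N) (TruncPoly M)} (hN : 2 ≤ N)
    (hM0 : 1 ≤ M) (hs : HoldsData d μ s) :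
    Runs iterationAndMoments s (400000 * ((d + 1) * ((n + 1) * (N ^ 3 * (M + 1) ^ 3)))) fun s' =>
      HoldsMatrix (matrixIterate μ (d * M)) s' ∧
      (∀ m ≤ M, s'.num 4 [m] =
        truncCoeff m (matrixIterate μ (d * M) (firstIdx hN) (lastIdx hN))) ∧
      s'.num 5 [] = momentTable (s.num 1 []) (fun m => if m = 0 then 1 else
        truncCoeff m (matrixIterate μ (d * M) (firstIdx hN) (lastIdx hN))) M 0 := by
  refine (Runs.seq (runs_iteration (by omega) hM0 hs) fun s1 hA1 h1 => Runs.seq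
    (runs_readMoments (M := M) ?_) fun s2 hA2 h2 =>
    (runs_computeTable (M := M) ?_ h2.1 (fun m => if m = 0 then 1 else
        truncCoeff m (matrixIterate μ (d * M) (firstIdx hN) (lastIdx hN))) ?_).mono le_rfl
      fun s3 hA3 h3 => ⟨?_, ?_, ?_⟩).of_le ?_
  · rw [hA1.nat 1 (by decide), hs.order]
  · rw [hA2.nat 1 (by decide), hA1.nat 1 (by decide), hs.order]
  · intro m hm
    rw [(h2.2 m hm).2, hA1.nat 5 (by decide), hs.size]
    exact if_congr Iff.rfl rfl (h1 (firstIdx hN) (lastIdx hN) m hm)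
  · have e : (M + 1) ^ 3 ≤ (d + 1) * ((n + 1) * (N ^ 3 * (M + 1) ^ 3)) := by
      calc (M + 1) ^ 3 = 1 * (1 * (1 * (M + 1) ^ 3)) := by ring
        _ ≤ _ := Nat.mul_le_mul (by omega) (Nat.mul_le_mul (by omega)
          (Nat.mul_le_mul_right _ (Nat.pow_pos (by omega))))
    have e1 : (M + 1) ≤ (M + 1) ^ 3 := Nat.le_self_pow (by omega) _
    have e2 : (M + 1) ^ 2 ≤ (M + 1) ^ 3 := Nat.pow_le_pow_right (by omega) (by omega)
    omega
  · exact (h1.of_agree hA2 (by decide)).of_agree hA3 (by decide)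
  · intro m hm
    rw [hA3.num 4 (by decide), (h2.2 m hm).1, hA1.nat 5 (by decide), hs.size]
    exact h1 (firstIdx hN) (lastIdx hN) m hm
  · rw [h3, hA2.num 1 (by decide), hA1.num 1 (by decide)]

end Moments

end Machine

/-! ### The program that builds a representation. -/

namespace Machine

section Encoding

/-- The state from which the letter `x` of the word `j` is read. -/
def srcState (d j x : ℕ) : ℕ := if x = 0 then 0 else j * d + x

/-- The cells to which reading the letter `x` of the word `j` contributes. -/
def edgeCell (len : ℕ → ℕ) (letter : ℕ → ℕ → ℕ) (α : ℕ → ℂ) (d last j x : ℕ) (idx : List ℕ) : ℂ :=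
  if len j ≤ x + 1 then
    (if idx = [letter j x, srcState d j x, 0, 1] then α j else 0) +
      (if idx = [letter j x, srcState d j x, last, 1] then α j else 0)
  else if idx = [letter j x, srcState d j x, j * d + x + 1, 0] then 1 else 0

/-- Store the degree in the scalar `6`. -/
def computeDegree : Program :=
  .loop 21 (.cell 2 []) (.ite (.cell 3 [21]) (.cell 6 []) .skip (.setNat 6 [] (.cell 3 [21])))

/-- Store the size of the matrices in the scalar `5`. -/
def computeSize : Program :=
  .seq (.setNat 5 [] (.const 2)) (.loop 21 (.cell 2 []) (.setNat 5 [] (.add (.cell 5 []) (.cell 6 []))))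

/-- Add `e` to a cell. -/
def addTo (a : ℕ) (idx : List ℕ) (e : NumExp) : Program := .setNum a idx (.add (.cell a idx) e)

/-- Enter the transition that reads the letter number `24` of the word number `21`. -/
def encodeLetter : Program :=
  .seq (.setNat 25 [] (.cell 4 [21, 24])) (.seq (.ite (.cell 24 []) (.const 0) (.setNat 26 [] (.const 0))
    (.setNat 26 [] (.add (.cell 22 []) (.cell 24 []))))
    (.ite (.cell 3 [21]) (.add (.cell 24 []) (.const 1))
      (.seq (addTo 2 [25, 26, 29, 30] (.cell 0 [21])) (addTo 2 [25, 26, 28, 30] (.cell 0 [21])))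
      (.seq (.setNat 27 [] (.add (.add (.cell 22 []) (.cell 24 [])) (.const 1)))
        (addTo 2 [25, 26, 27, 29] .one))))

/-- Enter the word number `21`. -/
def encodeWord : Program :=
  .seq (.ite (.cell 3 [21]) (.const 0) (addTo 1 [] (.cell 0 [21])) .skip)
    (.seq (.loop 24 (.cell 3 [21]) encodeLetter) (.setNat 22 [] (.add (.cell 22 []) (.cell 6 []))))

/-- Compute the constant term, the size and the matrices. -/
def encode : Program :=
  .seq computeDegree (.seq computeSize (.seq (.setNat 28 [] (.sub (.cell 5 []) (.const 1)))
    (.seq (.setNat 30 [] (.const 1)) (.loop 21 (.cell 2 []) encodeWord))))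

variable {s : Store ℂ} {m : ℕ}

theorem runs_computeDegree (hm : s.nat 2 [] = m) (h6 : s.nat 6 [] = 0) :
    Runs computeDegree s (20 * (m + 1)) fun s' =>
      s'.nat 6 [] = (Finset.range m).sup fun j => s.nat 3 [j] := by
  refine (Runs.loop (B := m) (E := m) (T := 10) (e := .cell 2 []) (fun i s' => s'.nat 6 [] =
    (Finset.range i).sup fun j => s.nat 3 [j]) hm le_rfl ?_ (by simpa using h6) ?_).of_le ?_
  · intro i s' v h
    rwa [Store.setNat_nat_of_ne _ (by decide)]
  · intro i s1 hi hA hi1 hI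
    have h3 : s1.nat 3 = s.nat 3 := hA.nat 3 (by decide)
    rw [Finset.range_add_one, Finset.sup_insert, sup_comm]
    refine (Runs.ite (T := 3) (fun h => (Runs.skip ?_).of_le (by omega))
      fun h => Runs.setNat ?_).of_le (by decide)
    · simp only [NatExp.eval, Store.index, List.map_cons, List.map_nil, hi1, h3] at h
      rw [hI] at h ⊢
      exact (sup_eq_left.2 h).symm
    · simp only [NatExp.eval, Store.index, List.map_cons, List.map_nil, hi1, h3] at h
      refine (Store.setNat_nat_self _ _ _ _).trans ?_
      simp only [NatExp.eval, Store.index, List.map_cons, List.map_nil, hi1, h3]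
      rw [hI] at h
      exact (sup_eq_right.2 h.le).symm
  · simp only [NatExp.cost, List.length_nil]
    omega

theorem runs_computeSize {d : ℕ} (hm : s.nat 2 [] = m) (h6 : s.nat 6 [] = d) :
    Runs computeSize s (20 * (m + 1)) fun s' => s'.nat 5 [] = 2 + m * d := by
  refine (Runs.seq (P := fun s' => s'.nat 5 [] = 2) (Runs.setNat
    (Store.setNat_nat_self _ _ _ _)) fun s1 hA1 h1 => Runs.loop (B := m) (E := m) (T := 10)
    (e := .cell 2 []) (fun i s' => s'.nat 5 [] = 2 + i * d) ?_ le_rfl ?_ (by simpa using h1)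
    ?_).of_le ?_
  · exact (congrFun (hA1.nat 2 (by decide)) []).trans hm
  · intro i s' v h
    rwa [Store.setNat_nat_of_ne _ (by decide)]
  · intro i s2 hi hA2 hi2 hI
    refine (Runs.setNat ?_).of_le (by decide)
    refine (Store.setNat_nat_self _ _ _ _).trans ?_
    simp only [NatExp.eval, Store.index, List.map_nil]
    rw [hI, hA2.nat 6 (by decide), hA1.nat 6 (by decide), h6]
    ring
  · simp only [NatExp.cost, List.length_nil]
    omega

/-- Because transitions are added to the cells and not written over them, the final contents are a
sum over all letters of all words, and no disjointness of cells has to be proved. -/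
theorem addTo_num (a : ℕ) (idx : List ℕ) (e : NumExp) (i : List ℕ) :
    (s.setNum a (s.index idx) (NumExp.eval s (.add (.cell a idx) e))).num a i =
      s.num a i + if i = s.index idx then e.eval s else 0 := by
  by_cases h : i = s.index idx
  · subst h
    rw [Store.setNum_num_self, if_pos rfl]
    rfl
  · rw [if_neg h, add_zero]
    exact if_neg fun h' => h h'.2

/-- The last letter of a word carries the coefficient and the factor z, and enters two transitions:
to the state 0, where another monomial may begin, and to the final state. Every other letter leads
to the next state of its block with weight 1. -/
theorem runs_encodeLetter {d j x last : ℕ} {len : ℕ → ℕ} {letter : ℕ → ℕ → ℕ} {α : ℕ → ℂ}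
    (h21 : s.nat 21 [] = j) (h22 : s.nat 22 [] = j * d) (h24 : s.nat 24 [] = x)
    (h28 : s.nat 28 [] = last) (h29 : s.nat 29 [] = 0) (h30 : s.nat 30 [] = 1)
    (hlen : s.nat 3 [j] = len j) (hletter : s.nat 4 [j, x] = letter j x)
    (hα : s.num 0 [j] = α j) :
    Runs encodeLetter s 100 fun s' =>
      ∀ i, s'.num 2 i = s.num 2 i + edgeCell len letter α d last j x i := by
  refine (Runs.seq (P := fun s' => s'.nat 25 [] = letter j x) (Runs.setNat ?_) fun s1 hA1 h1 =>
    Runs.seq (P := fun s' => s'.nat 26 [] = srcState d j x) (Runs.ite (T := 4) (fun h =>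
      (Runs.setNat ?_).of_le (by decide)) fun h => Runs.setNat ?_) fun s2 hA2 h2 =>
    Runs.ite (T := 40) (fun h => ?_) fun h => ?_).of_le (by decide)
  · refine (Store.setNat_nat_self _ _ _ _).trans ?_
    simpa only [NatExp.eval, Store.index, List.map_cons, List.map_nil, h21, h24] using hletter
  · refine (Store.setNat_nat_self _ _ _ _).trans ?_
    simp only [NatExp.eval, Store.index, List.map_nil, hA1.nat 24 (by decide), h24] at h
    rw [srcState, if_pos (by omega)]
    rfl
  · refine (Store.setNat_nat_self _ _ _ _).trans ?_
    simp only [NatExp.eval, Store.index, List.map_nil, hA1.nat 24 (by decide), h24] at h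
    rw [srcState, if_neg (by omega)]
    simp only [NatExp.eval, Store.index, List.map_nil, hA1.nat 24 (by decide),
      hA1.nat 22 (by decide), h22, h24]
  all_goals
    have g21 : s2.nat 21 [] = j := by rw [hA2.nat 21 (by decide), hA1.nat 21 (by decide), h21]
    have g22 : s2.nat 22 [] = j * d := by rw [hA2.nat 22 (by decide), hA1.nat 22 (by decide), h22]
    have g24 : s2.nat 24 [] = x := by rw [hA2.nat 24 (by decide), hA1.nat 24 (by decide), h24]
    have g25 : s2.nat 25 [] = letter j x := by rw [hA2.nat 25 (by decide), h1]
    have g28 : s2.nat 28 [] = last := by rw [hA2.nat 28 (by decide), hA1.nat 28 (by decide), h28]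
    have g29 : s2.nat 29 [] = 0 := by rw [hA2.nat 29 (by decide), hA1.nat 29 (by decide), h29]
    have g30 : s2.nat 30 [] = 1 := by rw [hA2.nat 30 (by decide), hA1.nat 30 (by decide), h30]
    have glen : s2.nat 3 [j] = len j := by rw [hA2.nat 3 (by decide), hA1.nat 3 (by decide), hlen]
    have gα : s2.num 0 [j] = α j := by rw [hA2.num 0 (by decide), hA1.num 0 (by decide), hα]
    have g2 : s2.num 2 = s.num 2 := by rw [hA2.num 2 (by decide), hA1.num 2 (by decide)]
    simp only [NatExp.eval, Store.index, List.map_cons, List.map_nil, g21, g24, glen] at h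
  · refine (Runs.seq (P := fun s' => ∀ i, s'.num 2 i = s.num 2 i +
      if i = [letter j x, srcState d j x, 0, 1] then α j else 0) (Runs.setNum fun i => ?_)
      fun s3 hA3 h3 => Runs.setNum fun i => ?_).of_le (by decide)
    · rw [addTo_num, g2]
      simp only [NumExp.eval, Store.index, List.map_cons, List.map_nil, g25, h2, g29, g30, g21, gα]
    · rw [addTo_num, h3, edgeCell, if_pos h, add_assoc]
      have hn : s3.nat = s2.nat := funext fun a => hA3.nat a (by simp [Program.natWrites])
      have h0 : s3.num 0 = s2.num 0 := hA3.num 0 (by decide)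
      simp only [NumExp.eval, Store.index, List.map_cons, List.map_nil, hn, g25, h2, g28, g30, g21,
        h0, gα]
  · refine (Runs.seq (P := fun s' => s'.nat 27 [] = j * d + x + 1) (Runs.setNat ?_)
      fun s3 hA3 h3 => Runs.setNum fun i => ?_).of_le (by decide)
    · refine (Store.setNat_nat_self _ _ _ _).trans ?_
      simp only [NatExp.eval, Store.index, List.map_nil, g22, g24]
    · rw [addTo_num, hA3.num 2 (by decide), g2, edgeCell,
        if_neg (show ¬len j ≤ x + 1 by omega)]
      simp only [NumExp.eval, Store.index, List.map_cons, List.map_nil, hA3.nat 25 (by decide), g25,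
        hA3.nat 26 (by decide), h2, hA3.nat 29 (by decide), g29, h3]

theorem runs_encodeWord {d j last : ℕ} {len : ℕ → ℕ} {letter : ℕ → ℕ → ℕ} {α : ℕ → ℂ}
    (h6 : s.nat 6 [] = d) (h21 : s.nat 21 [] = j) (h22 : s.nat 22 [] = j * d)
    (h28 : s.nat 28 [] = last) (h29 : s.nat 29 [] = 0) (h30 : s.nat 30 [] = 1)
    (hlen : s.nat 3 [j] = len j) (hletter : ∀ x < len j, s.nat 4 [j, x] = letter j x)
    (hα : s.num 0 [j] = α j) (hd : len j ≤ d) :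
    Runs encodeWord s (200 * (d + 1)) fun s' => s'.nat 22 [] = (j + 1) * d ∧
      s'.num 1 [] = s.num 1 [] + (if len j = 0 then α j else 0) ∧
      ∀ i, s'.num 2 i = s.num 2 i + ∑ x ∈ Finset.range (len j),
        edgeCell len letter α d last j x i := by
  refine (Runs.seq (P := fun s' => s'.num 1 [] = s.num 1 [] + if len j = 0 then α j else 0)
    (Runs.ite (T := 10) (fun h => (Runs.setNum ?_).of_le (by decide))
      fun h => (Runs.skip ?_).of_le (by omega)) fun s1 hA1 h1 =>
    Runs.seq (P := fun s' => ∀ i, s'.num 2 i = s.num 2 i + ∑ x ∈ Finset.range (len j),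
        edgeCell len letter α d last j x i) (T := 3 + d * 101) ?_ fun s2 hA2 h2 =>
      Runs.setNat ⟨?_, ?_, h2⟩).of_le ?_
  · simp only [NatExp.eval, Store.index, List.map_cons, List.map_nil, h21, hlen] at h
    rw [addTo_num, if_pos (show [] = s.index [] from rfl), if_pos (by omega)]
    simp only [NumExp.eval, Store.index, List.map_cons, List.map_nil, h21, hα]
  · simp only [NatExp.eval, Store.index, List.map_cons, List.map_nil, h21, hlen] at h
    rw [if_neg (by omega), add_zero]
  · have hn : s1.nat = s.nat := funext fun a => hA1.nat a (by simp [Program.natWrites])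
    refine Runs.loop (B := d) (E := len j) (T := 100) (fun x s' => ∀ i, s'.num 2 i = s.num 2 i +
      ∑ y ∈ Finset.range x, edgeCell len letter α d last j y i) ?_ hd (fun _ _ _ h => h) ?_ ?_
    · simp only [NatExp.eval, Store.index, List.map_cons, List.map_nil, hn, h21, hlen]
    · intro i
      rw [hA1.num 2 (by decide), Finset.sum_range_zero, add_zero]
    · intro x s3 hx hA3 hx3 hI3
      refine (runs_encodeLetter (d := d) (j := j) (x := x) (last := last) (len := len)
        (letter := letter) (α := α) ?_ ?_ hx3 ?_ ?_ ?_ ?_ ?_ ?_).mono le_rfl ?_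
      · rw [hA3.nat 21 (by decide), hn, h21]
      · rw [hA3.nat 22 (by decide), hn, h22]
      · rw [hA3.nat 28 (by decide), hn, h28]
      · rw [hA3.nat 29 (by decide), hn, h29]
      · rw [hA3.nat 30 (by decide), hn, h30]
      · rw [hA3.nat 3 (by decide), hn, hlen]
      · rw [hA3.nat 4 (by decide), hn, hletter x hx]
      · rw [hA3.num 0 (by decide), hA1.num 0 (by decide), hα]
      · intro s4 _ h4 i
        rw [h4, hI3, Finset.sum_range_succ, add_assoc]
  · simp only [NatExp.cost, List.length_nil, List.length_cons]
    omega
  · refine (Store.setNat_nat_self _ _ _ _).trans ?_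
    simp only [NatExp.eval, Store.index, List.map_nil, hA2.nat 22 (by decide),
      hA1.nat 22 (by decide), h22, hA2.nat 6 (by decide), hA1.nat 6 (by decide), h6]
    ring
  · exact (congrFun (hA2.num 1 (by decide)) []).trans h1

/-- The scalar `22` runs through the multiples j * d by repeated addition. The scalar `29` is never
assigned: its initial value 0 serves as a constant index. -/
theorem runs_encode {len : ℕ → ℕ} {letter : ℕ → ℕ → ℕ} {α : ℕ → ℂ} {d : ℕ} (hm : s.nat 2 [] = m)
    (h6 : s.nat 6 [] = 0) (h22 : s.nat 22 [] = 0) (h29 : s.nat 29 [] = 0)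
    (h1 : s.num 1 [] = 0) (h2 : s.num 2 = 0)
    (hlen : ∀ j < m, s.nat 3 [j] = len j)
    (hletter : ∀ j < m, ∀ x < len j, s.nat 4 [j, x] = letter j x)
    (hα : ∀ j < m, s.num 0 [j] = α j) (hd : (Finset.range m).sup len = d) :
    Runs encode s (500 * ((m + 1) * (d + 1))) fun s' => s'.nat 6 [] = d ∧
      s'.nat 5 [] = 2 + m * d ∧
      s'.num 1 [] = ∑ j ∈ Finset.range m, (if len j = 0 then α j else 0) ∧
      ∀ i, s'.num 2 i = ∑ j ∈ Finset.range m, ∑ x ∈ Finset.range (len j),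
        edgeCell len letter α d (1 + m * d) j x i := by
  refine (Runs.seq (runs_computeDegree hm h6) fun s1 hA1 k1 => Runs.seq (runs_computeSize (d := d)
    (m := m) ?_ ?_) fun s2 hA2 k2 => Runs.seq (P := fun s' => s'.nat 28 [] = 1 + m * d)
    (Runs.setNat ?_) fun s3 hA3 k3 => Runs.seq (P := fun s' => s'.nat 30 [] = 1)
    (Runs.setNat (Store.setNat_nat_self _ _ _ _)) fun s4 hA4 k4 => (Runs.loop (B := m) (E := m)
    (T := 200 * (d + 1)) (fun j s' => s'.nat 22 [] = j * d ∧
      s'.num 1 [] = ∑ y ∈ Finset.range j, (if len y = 0 then α y else 0) ∧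
      ∀ i, s'.num 2 i = ∑ y ∈ Finset.range j, ∑ x ∈ Finset.range (len y),
        edgeCell len letter α d (1 + m * d) y x i) ?_ le_rfl ?_ ⟨?_, ?_, ?_⟩ ?_).mono le_rfl
    fun s5 hA5 k5 => ⟨?_, ?_, k5.2⟩).of_le ?_
  · rw [hA1.nat 2 (by decide), hm]
  · rw [k1, ← hd]
    exact Finset.sup_congr rfl fun j hj => hlen j (Finset.mem_range.1 hj)
  · refine (Store.setNat_nat_self _ _ _ _).trans ?_
    simp only [NatExp.eval, Store.index, List.map_nil, k2]
    omega
  · exact (congrFun ((((hA4.nat 2 (by decide)).trans (hA3.nat 2 (by decide))).trans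
      (hA2.nat 2 (by decide))).trans (hA1.nat 2 (by decide))) []).trans hm
  · intro i s' v h
    rw [Store.setNat_nat_of_ne _ (by decide)]
    exact h
  · rw [hA4.nat 22 (by decide), hA3.nat 22 (by decide), hA2.nat 22 (by decide),
      hA1.nat 22 (by decide), h22, zero_mul]
  · rw [hA4.num 1 (by decide), hA3.num 1 (by decide), hA2.num 1 (by decide),
      hA1.num 1 (by decide), h1, Finset.sum_range_zero]
  · intro i
    rw [hA4.num 2 (by decide), hA3.num 2 (by decide), hA2.num 2 (by decide),
      hA1.num 2 (by decide), h2, Finset.sum_range_zero]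
    rfl
  · intro j s5 hj hA5 hj5 hI5
    have hdeg : len j ≤ d := hd ▸ Finset.le_sup (f := len) (Finset.mem_range.2 hj)
    refine (runs_encodeWord (d := d) (j := j) (last := 1 + m * d) (len := len) (letter := letter)
      (α := α) ?_ hj5 hI5.1 ?_ ?_ ?_ ?_ ?_ ?_ hdeg).mono le_rfl ?_
    · rw [hA5.nat 6 (by decide), hA4.nat 6 (by decide), hA3.nat 6 (by decide),
        hA2.nat 6 (by decide), k1, ← hd]
      exact Finset.sup_congr rfl fun j hj => hlen j (Finset.mem_range.1 hj)
    · rw [hA5.nat 28 (by decide), hA4.nat 28 (by decide), k3]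
    · rw [hA5.nat 29 (by decide), hA4.nat 29 (by decide), hA3.nat 29 (by decide),
        hA2.nat 29 (by decide), hA1.nat 29 (by decide), h29]
    · rw [hA5.nat 30 (by decide), k4]
    · rw [hA5.nat 3 (by decide), hA4.nat 3 (by decide), hA3.nat 3 (by decide),
        hA2.nat 3 (by decide), hA1.nat 3 (by decide), hlen j hj]
    · intro x hx
      rw [hA5.nat 4 (by decide), hA4.nat 4 (by decide), hA3.nat 4 (by decide),
        hA2.nat 4 (by decide), hA1.nat 4 (by decide), hletter j hj x hx]
    · rw [hA5.num 0 (by decide), hA4.num 0 (by decide), hA3.num 0 (by decide),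
        hA2.num 0 (by decide), hA1.num 0 (by decide), hα j hj]
    · intro s6 _ h6
      refine ⟨h6.1, ?_, fun i => ?_⟩
      · rw [h6.2.1, hI5.2.1, Finset.sum_range_succ]
      · rw [h6.2.2, hI5.2.2, Finset.sum_range_succ]
  · simp only [NatExp.cost, List.length_nil]
    nlinarith
  · rw [hA5.nat 6 (by decide), hA4.nat 6 (by decide), hA3.nat 6 (by decide),
      hA2.nat 6 (by decide), k1, ← hd]
    exact Finset.sup_congr rfl fun j hj => hlen j (Finset.mem_range.1 hj)
  · rw [hA5.nat 5 (by decide), hA4.nat 5 (by decide), hA3.nat 5 (by decide), k2]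

end Encoding

end Machine

/-! ### The weighted automaton of a pseudo-inverse. -/

namespace NCPoly

section PrefixCoeff

variable {R : Type*} [Semiring R] {n : ℕ}

/-- The coefficient of a word in the product of a monomial and a series. -/
def prefixCoeff (β : R) (f : FreeMonoid (Fin n) → R) : List (Fin n) → List (Fin n) → R
  | [], F => β * f (FreeMonoid.ofList F)
  | _ :: _, [] => 0
  | i :: u, k :: F => if k = i then prefixCoeff β f u F else 0

theorem prefixCoeff_nil_right (β : R) (f : FreeMonoid (Fin n) → R) {u : List (Fin n)}
    (hu : u ≠ []) : prefixCoeff β f u [] = 0 := by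
  cases u with
  | nil => exact absurd rfl hu
  | cons i u => rfl

theorem prefixCoeff_congr (β : R) {f g : FreeMonoid (Fin n) → R} (u F : List (Fin n))
    (h : ∀ G : List (Fin n), G.length ≤ F.length → f (FreeMonoid.ofList G) = g (FreeMonoid.ofList G)) :
    prefixCoeff β f u F = prefixCoeff β g u F := by
  induction u generalizing F with
  | nil => rw [prefixCoeff, prefixCoeff, h F le_rfl]
  | cons i u ih =>
    cases F with
    | nil => rfl
    | cons k F =>
      rw [prefixCoeff, prefixCoeff, ih F fun G hG => h G (hG.trans (Nat.le_succ _))]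

theorem coeff_single_ofList_mul (β : R) (b : NCPoly R n) (u F : List (Fin n)) :
    (MonoidAlgebra.single (FreeMonoid.ofList u) β * b).coeff (FreeMonoid.ofList F) =
      prefixCoeff β b.coeff u F := by
  induction u generalizing F with
  | nil => exact MonoidAlgebra.coeff_single_one_mul _ _ _
  | cons i u ih =>
    have : (MonoidAlgebra.single (FreeMonoid.ofList (i :: u)) β : NCPoly R n) =
        MonoidAlgebra.single (FreeMonoid.of i) 1 * MonoidAlgebra.single (FreeMonoid.ofList u) β := by
      rw [MonoidAlgebra.single_mul_single, one_mul, FreeMonoid.ofList_cons]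
    rw [this, mul_assoc]
    cases F with
    | nil => exact coeff_single_of_mul_nil _ _ _
    | cons k F => rw [coeff_single_of_mul_cons, one_mul, ih, prefixCoeff]

/-- The series `1 + a ^ *`. -/
noncomputable def starSeries (a : NCPoly R n) (F : FreeMonoid (Fin n)) : R :=
  (∑ k ∈ Finset.range (F.length + 1), a ^ k).coeff F

theorem coeff_geomSum_eq_starSeries (a : NCPoly R n) (ha : a.coeff 1 = 0)
    (F : FreeMonoid (Fin n)) {K : ℕ} (hK : F.length + 1 ≤ K) :
    (∑ k ∈ Finset.range K, a ^ k).coeff F = starSeries a F := by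
  rw [starSeries, MonoidAlgebra.coeff_sum, MonoidAlgebra.coeff_sum, Finsupp.finsetSum_apply,
    Finsupp.finsetSum_apply]
  refine (Finset.sum_subset (Finset.range_subset_range.2 hK) fun k _ hk => ?_).symm
  rw [Finset.mem_range] at hk
  exact coeff_pow_eq_zero a ha k F (by omega)

theorem starSeries_nil (a : NCPoly R n) : starSeries a (FreeMonoid.ofList []) = 1 := by
  rw [starSeries, show (FreeMonoid.ofList ([] : List (Fin n))).length = 0 from rfl]
  simp only [zero_add, Finset.sum_range_one, pow_zero]
  exact MonoidAlgebra.coeff_one_one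

theorem starSeries_cons (a : NCPoly R n) (i : Fin n) (F : List (Fin n)) :
    starSeries a (FreeMonoid.ofList (i :: F)) = pseudoInverse a (FreeMonoid.ofList (i :: F)) := by
  rw [starSeries, pseudoInverse, Finset.sum_range_succ', MonoidAlgebra.coeff_add, Finsupp.add_apply,
    pow_zero, coeff_one_ofList_cons, add_zero, MonoidAlgebra.coeff_sum, Finsupp.finsetSum_apply,
    Finset.range_eq_Ico, Finset.sum_Ico_add' (fun k => (a ^ k).coeff (FreeMonoid.ofList (i :: F)))]
  rfl

theorem pseudoInverse_nil (a : NCPoly R n) : pseudoInverse a (FreeMonoid.ofList []) = 0 := rfl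

/-- This is a^* = a (1 + a^*), expanded over the monomials of the left factor. The geometric sum may
be cut at the length of the word, since higher powers have no words that short. -/
theorem pseudoInverse_eq_sum_prefixCoeff (a : NCPoly R n) (ha : a.coeff 1 = 0) (m : ℕ)
    (W : ℕ → List (Fin n)) (β : ℕ → R)
    (haW : a = ∑ j ∈ Finset.range m, if W j = [] then 0 else
      MonoidAlgebra.single (FreeMonoid.ofList (W j)) (β j)) (F : List (Fin n)) :
    pseudoInverse a (FreeMonoid.ofList F) = ∑ j ∈ Finset.range m, if W j = [] then 0 else
      prefixCoeff (β j) (starSeries a) (W j) F := by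
  have h1 : pseudoInverse a (FreeMonoid.ofList F) =
      (a * ∑ k ∈ Finset.range (F.length + 1), a ^ k).coeff (FreeMonoid.ofList F) := by
    rw [Finset.mul_sum, Finset.sum_range_succ, MonoidAlgebra.coeff_add, Finsupp.add_apply]
    simp only [← pow_succ']
    rw [coeff_pow_eq_zero a ha (F.length + 1) (FreeMonoid.ofList F) (Nat.lt_succ_self _), add_zero,
      MonoidAlgebra.coeff_sum, Finsupp.finsetSum_apply, Finset.range_eq_Ico,
      Finset.sum_Ico_add' (fun k => (a ^ k).coeff (FreeMonoid.ofList F))]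
    rfl
  have h2 : ∀ b : NCPoly R n, (a * b).coeff (FreeMonoid.ofList F) =
      ∑ j ∈ Finset.range m, if W j = [] then 0 else prefixCoeff (β j) b.coeff (W j) F := by
    intro b
    rw [haW, Finset.sum_mul, MonoidAlgebra.coeff_sum, Finsupp.finsetSum_apply]
    refine Finset.sum_congr rfl fun j _ => ?_
    split_ifs with hW
    · rw [zero_mul]; rfl
    · rw [coeff_single_ofList_mul]
  rw [h1, h2]
  refine Finset.sum_congr rfl fun j _ => ?_
  split_ifs with hW
  · rfl
  · exact prefixCoeff_congr _ _ _ fun G hG =>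
      coeff_geomSum_eq_starSeries a ha _ (Nat.succ_le_succ hG)

end PrefixCoeff

section Automaton

open Machine

variable {R : Type*} [Semiring R] {n : ℕ} (W : ℕ → List (Fin n)) (β : ℕ → R) (d m : ℕ)

/-- The weight of the transition from `x` to `y` that reads the letter `i`. -/
def edgeWeight (i : Fin n) (x y : ℕ) : R :=
  ∑ j ∈ Finset.range m, ∑ t ∈ Finset.range (W j).length,
    if (W j)[t]? = some i ∧ x = srcState d j t then
      if (W j).length ≤ t + 1 then
        (if y = 0 then β j else 0) + (if y = 1 + m * d then β j else 0)
      else if y = j * d + t + 1 then 1 else 0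
    else 0

/-- The total weight of the paths from the state `x` to the final state that read a word. -/
noncomputable def pathWeight (a : NCPoly R n) (x : ℕ) (F : List (Fin n)) : R :=
  (if x = 1 + m * d ∧ F = [] then 1 else 0) +
    ∑ j ∈ Finset.range m, ∑ t ∈ Finset.range (W j).length,
      if x = srcState d j t then prefixCoeff (β j) (starSeries a) ((W j).drop t) F else 0

variable {W β d m}

theorem srcState_le {j t : ℕ} (hj : j < m) (ht : t < d) : srcState d j t ≤ m * d := by
  have : (j + 1) * d ≤ m * d := Nat.mul_le_mul_right _ hj
  rw [Nat.succ_mul] at this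
  rw [srcState]
  split_ifs <;> omega

/-- Division with remainder by `d` recovers the word and the position from an inner state. -/
theorem srcState_eq_iff {j j' t t' : ℕ} (ht : t + 1 < d) (ht' : t' < d) :
    j * d + t + 1 = srcState d j' t' ↔ j' = j ∧ t' = t + 1 := by
  constructor
  · intro h
    rw [srcState] at h
    split_ifs at h
    have h1 : j' = j := by
      have e1 : (j * d + (t + 1)) / d = j := by
        rw [mul_comm, Nat.mul_add_div (by omega), Nat.div_eq_of_lt ht, add_zero]
      have e2 : (j' * d + t') / d = j' := by
        rw [mul_comm, Nat.mul_add_div (by omega), Nat.div_eq_of_lt ht', add_zero]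
      rw [← e1, ← e2, ← h, add_assoc]
    subst h1
    exact ⟨rfl, by omega⟩
  · rintro ⟨rfl, rfl⟩
    rw [srcState, if_neg (by omega), add_assoc]

theorem pathWeight_last (a : NCPoly R n) (hd : ∀ j < m, (W j).length ≤ d) (F : List (Fin n)) :
    pathWeight W β d m a (1 + m * d) F = if F = [] then 1 else 0 := by
  rw [pathWeight, Finset.sum_eq_zero, add_zero]
  · simp
  · intro j hj
    rw [Finset.mem_range] at hj
    refine Finset.sum_eq_zero fun t ht => if_neg ?_
    rw [Finset.mem_range] at ht
    have := srcState_le (d := d) hj (ht.trans_le (hd j hj))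
    omega

theorem pathWeight_zero (a : NCPoly R n) (ha : a.coeff 1 = 0)
    (haW : a = ∑ j ∈ Finset.range m, if W j = [] then 0 else
      MonoidAlgebra.single (FreeMonoid.ofList (W j)) (β j)) (F : List (Fin n)) :
    pathWeight W β d m a 0 F = pseudoInverse a (FreeMonoid.ofList F) := by
  rw [pathWeight, if_neg (by omega), zero_add, pseudoInverse_eq_sum_prefixCoeff a ha m W β haW]
  refine Finset.sum_congr rfl fun j _ => ?_
  split_ifs with hW
  · rw [hW]; rfl
  · rw [Finset.sum_eq_single 0]
    · rw [srcState, if_pos rfl, if_pos rfl, List.drop_zero]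
    · intro t _ ht
      rw [srcState, if_neg ht, if_neg (by omega)]
    · intro h
      exact absurd (Finset.mem_range.2 (List.length_pos_of_ne_nil hW)) h

theorem pathWeight_inner (a : NCPoly R n) (hd : ∀ j < m, (W j).length ≤ d) {j t : ℕ} (hj : j < m)
    (ht : t + 1 < (W j).length) (F : List (Fin n)) :
    pathWeight W β d m a (j * d + t + 1) F =
      prefixCoeff (β j) (starSeries a) ((W j).drop (t + 1)) F := by
  have htd : t + 1 < d := ht.trans_le (hd j hj)
  have hlt : j * d + t + 1 ≠ 1 + m * d := by
    have : (j + 1) * d ≤ m * d := Nat.mul_le_mul_right _ hj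
    rw [Nat.succ_mul] at this
    omega
  rw [pathWeight, if_neg (fun h => hlt h.1), zero_add, Finset.sum_eq_single j,
    Finset.sum_eq_single (t + 1)]
  · rw [if_pos ((srcState_eq_iff htd htd).2 ⟨rfl, rfl⟩)]
  · intro t' ht' hne
    rw [Finset.mem_range] at ht'
    rw [if_neg fun h => hne ((srcState_eq_iff htd (ht'.trans_le (hd j hj))).1 h).2]
  · intro h
    exact absurd (Finset.mem_range.2 ht) h
  · intro j' hj' hne
    rw [Finset.mem_range] at hj'
    refine Finset.sum_eq_zero fun t' ht' => if_neg fun h => hne ?_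
    rw [Finset.mem_range] at ht'
    exact ((srcState_eq_iff htd (ht'.trans_le (hd j' hj'))).1 h).1
  · intro h
    exact absurd (Finset.mem_range.2 hj) h

/-- Splitting a path after its first transition, letter by letter of each word: inside a word the
unread suffix becomes shorter, and after its last letter the continuation is the series 1 + a^*. -/
theorem sum_edgeWeight_mul_pathWeight (a : NCPoly R n) (ha : a.coeff 1 = 0)
    (haW : a = ∑ j ∈ Finset.range m, if W j = [] then 0 else
      MonoidAlgebra.single (FreeMonoid.ofList (W j)) (β j))
    (hd : ∀ j < m, (W j).length ≤ d) (i : Fin n) (x : ℕ) (F : List (Fin n)) :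
    ∑ y ∈ Finset.range (2 + m * d), edgeWeight W β d m i x y * pathWeight W β d m a y F =
      pathWeight W β d m a x (i :: F) := by
  simp only [edgeWeight, Finset.sum_mul]
  rw [Finset.sum_comm]
  simp only [Finset.sum_comm (s := Finset.range (2 + m * d))]
  rw [pathWeight, if_neg (by simp), zero_add]
  refine Finset.sum_congr rfl fun j hj => Finset.sum_congr rfl fun t ht => ?_
  rw [Finset.mem_range] at hj ht
  have hdrop : (W j).drop t = (W j)[t] :: (W j).drop (t + 1) := List.drop_eq_getElem_cons ht
  rw [hdrop, prefixCoeff]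
  simp only [List.getElem?_eq_getElem ht, Option.some.injEq]
  by_cases hx : x = srcState d j t
  swap
  · simp [hx]
  by_cases hi : (W j)[t] = i
  swap
  · simp [hi, Ne.symm hi]
  simp only [hx, hi, and_self, if_true]
  split_ifs with hlen
  -- The final state accounts for the 1 in 1 + a^*, with nothing left to read, and the state 0 for
  -- a^*, which has no constant term.
  · have hnil : (W j).drop (t + 1) = [] := List.drop_eq_nil_of_le hlen
    simp only [add_mul, ite_mul, zero_mul, Finset.sum_add_distrib, Finset.sum_ite_eq',
      Finset.mem_range]
    rw [if_pos (by omega), if_pos (by omega), pathWeight_zero a ha haW, pathWeight_last a hd, hnil,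
      prefixCoeff, ← mul_add]
    congr 1
    cases F with
    | nil => rw [starSeries_nil, pseudoInverse_nil, if_pos rfl, zero_add]
    | cons k F => rw [starSeries_cons, if_neg (by simp), add_zero]
  · have : (j + 1) * d ≤ m * d := Nat.mul_le_mul_right _ hj
    rw [Nat.succ_mul] at this
    have := hd j hj
    simp only [ite_mul, zero_mul, one_mul, Finset.sum_ite_eq', Finset.mem_range]
    rw [if_pos (by omega), pathWeight_inner a hd hj (by omega)]

/-- The matrix representation given by the transitions. -/
def edgeHom (W : ℕ → List (Fin n)) (β : ℕ → R) (d m : ℕ) :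
    FreeMonoid (Fin n) →* Matrix (Fin (2 + m * d)) (Fin (2 + m * d)) R :=
  FreeMonoid.lift fun i => Matrix.of fun x y => edgeWeight W β d m i x y

theorem represents_edgeHom (a : NCPoly R n) (ha : a.coeff 1 = 0)
    (haW : a = ∑ j ∈ Finset.range m, if W j = [] then 0 else
      MonoidAlgebra.single (FreeMonoid.ofList (W j)) (β j))
    (hd : ∀ j < m, (W j).length ≤ d) (hN : 2 ≤ 2 + m * d) :
    Represents hN (edgeHom W β d m) a.pseudoInverse := by
  -- Only the start at state 0 is wanted, but the induction on the word passes through all states.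
  have key : ∀ (F : List (Fin n)) (x : Fin (2 + m * d)),
      edgeHom W β d m (FreeMonoid.ofList F) x (lastIdx hN) = pathWeight W β d m a x F := by
    intro F
    induction F with
    | nil =>
      intro x
      rw [FreeMonoid.ofList_nil, map_one, Matrix.one_apply, pathWeight, Finset.sum_eq_zero,
        add_zero]
      · refine if_congr ?_ rfl rfl
        rw [Fin.ext_iff, lastIdx]
        simp only [and_true]
        omega
      · intro j _
        refine Finset.sum_eq_zero fun t ht => ?_
        rw [Finset.mem_range] at ht
        rw [prefixCoeff_nil_right, ite_self]
        rw [ne_eq, List.drop_eq_nil_iff]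
        omega
    | cons i F ih =>
      intro x
      rw [FreeMonoid.ofList_cons, map_mul, Matrix.mul_apply,
        ← sum_edgeWeight_mul_pathWeight a ha haW hd, Finset.sum_range]
      refine Finset.sum_congr rfl fun y _ => ?_
      rw [ih]
      simp [edgeHom]
  intro F
  have := key F.toList (firstIdx hN)
  rw [FreeMonoid.ofList_toList] at this
  rw [this, firstIdx]
  exact (pathWeight_zero a ha haW F.toList).symm

end Automaton

end NCPoly

/-! ### The list of monomials, the degree and the size of the representation. -/

namespace NCPoly

section Monomials

variable {n : ℕ} {p : NCPoly ℂ n}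

/-- The words of a list of the monomials of a polynomial. -/
noncomputable def wordAt (words : Fin p.numMonomials ≃ p.coeff.support) (j : ℕ) : List (Fin n) :=
  if h : j < p.numMonomials then (words ⟨j, h⟩).1.toList else []

/-- The coefficients of a list of the monomials of a polynomial. -/
noncomputable def coeffAt (words : Fin p.numMonomials ≃ p.coeff.support) (j : ℕ) : ℂ :=
  if h : j < p.numMonomials then p.coeff (words ⟨j, h⟩).1 else 0

variable (words : Fin p.numMonomials ≃ p.coeff.support)

theorem sum_range_numMonomials {B : Type*} [AddCommMonoid B] (g : List (Fin n) → ℂ → B) :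
    ∑ j ∈ Finset.range p.numMonomials, g (wordAt words j) (coeffAt words j) =
      ∑ F ∈ p.coeff.support, g F.toList (p.coeff F) := by
  rw [Finset.sum_range, ← Finset.sum_coe_sort p.coeff.support fun F => g F.toList (p.coeff F),
    ← Equiv.sum_comp words]
  refine Finset.sum_congr rfl fun j _ => ?_
  rw [wordAt, coeffAt, dif_pos j.2, dif_pos j.2]

theorem sup_range_numMonomials :
    ((Finset.range p.numMonomials).sup fun j => (wordAt words j).length) = p.deg := by
  apply le_antisymm
  · refine Finset.sup_le fun j hj => ?_
    rw [Finset.mem_range] at hj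
    rw [wordAt, dif_pos hj]
    exact Finset.le_sup (f := FreeMonoid.length) (words ⟨j, hj⟩).2
  · refine Finset.sup_le fun F hF => ?_
    have h := (words.symm ⟨F, hF⟩).2
    have := Finset.le_sup (f := fun j => (wordAt words j).length) (Finset.mem_range.2 h)
    rw [wordAt, dif_pos h, Fin.eta, Equiv.apply_symm_apply] at this
    exact this

theorem length_wordAt_le (j : ℕ) (hj : j < p.numMonomials) : (wordAt words j).length ≤ p.deg := by
  rw [← sup_range_numMonomials words]
  exact Finset.le_sup (f := fun j => (wordAt words j).length) (Finset.mem_range.2 hj)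

theorem sum_coeffAt_eq_constPart :
    (∑ j ∈ Finset.range p.numMonomials,
      if (wordAt words j).length = 0 then coeffAt words j else 0) = p.constPart := by
  classical
  rw [sum_range_numMonomials words fun w c => if w.length = 0 then c else 0, constPart]
  have : ∀ F : FreeMonoid (Fin n), F.toList.length = 0 ↔ F = 1 := fun F =>
    FreeMonoid.length_eq_zero
  simp only [this]
  rw [Finset.sum_ite_eq']
  split_ifs with h
  · rfl
  · exact (Finsupp.notMem_support_iff.1 h).symm

theorem zMul_reducedPart_eq_sum :
    p.reducedPart.zMul = ∑ j ∈ Finset.range p.numMonomials, if wordAt words j = [] then 0 else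
      MonoidAlgebra.single (FreeMonoid.ofList (wordAt words j))
        (Polynomial.X * Polynomial.C (coeffAt words j)) := by
  classical
  rw [sum_range_numMonomials words fun w c => if w = [] then (0 : NCPoly ℂ[X] n) else
    MonoidAlgebra.single (FreeMonoid.ofList w) (Polynomial.X * Polynomial.C c)]
  rw [← MonoidAlgebra.coeff_inj]
  refine Finsupp.ext fun F => ?_
  have h1 := coeff_zMul_pow p.reducedPart 1 F
  rw [pow_one, pow_one, pow_one] at h1
  rw [h1, coeff_reducedPart, MonoidAlgebra.coeff_sum, Finsupp.finsetSum_apply,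
    Finset.sum_eq_single F]
  · have hF : F.toList = [] ↔ F = 1 := Iff.rfl
    simp only [hF]
    split_ifs with h
    · simp
    · rw [FreeMonoid.ofList_toList, MonoidAlgebra.coeff_single, Finsupp.single_eq_same]
  · intro G _ hne
    split_ifs with h
    · rfl
    · rw [FreeMonoid.ofList_toList, MonoidAlgebra.coeff_single, Finsupp.single_eq_of_ne hne.symm]
  · intro h
    rw [Finsupp.notMem_support_iff.1 h]
    split_ifs <;> simp

theorem support_reducedPart [DecidableEq (FreeMonoid (Fin n))] (p : NCPoly ℂ n) :
    p.reducedPart.coeff.support = p.coeff.support.erase 1 := by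
  ext F
  rw [Finset.mem_erase, Finsupp.mem_support_iff, Finsupp.mem_support_iff, coeff_reducedPart]
  by_cases h : F = 1 <;> simp [h]

theorem deg_reducedPart (p : NCPoly ℂ n) : p.reducedPart.deg = p.deg := by
  classical
  rw [deg, deg, support_reducedPart]
  apply le_antisymm (Finset.sup_mono (Finset.erase_subset _ _))
  refine Finset.sup_le fun F hF => ?_
  by_cases h : F = 1
  · rw [h, FreeMonoid.length_one]
    exact Nat.zero_le _
  · exact Finset.le_sup (f := FreeMonoid.length) (Finset.mem_erase.2 ⟨h, hF⟩)

theorem numMonomials_le (p : NCPoly ℂ n) : p.numMonomials ≤ p.reducedPart.numMonomials + 1 := by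
  classical
  have := Finset.pred_card_le_card_erase (s := p.coeff.support) (a := 1)
  rw [numMonomials, numMonomials, support_reducedPart]
  omega

theorem numMonomials_pos {p : NCPoly ℂ n} (h : 1 ≤ p.deg) : 1 ≤ p.numMonomials := by
  by_contra h0
  have : p.coeff.support = ∅ := Finset.card_eq_zero.1 (by rw [numMonomials] at h0; omega)
  rw [deg, this] at h
  simp at h

theorem vars_pos {p : NCPoly ℂ n} (h : 1 ≤ p.deg) : 1 ≤ n := by
  by_contra h0
  obtain rfl : n = 0 := by omega
  have : p.deg ≤ 0 := Finset.sup_le fun F _ => by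
    rw [Subsingleton.elim F 1, FreeMonoid.length_one]
  omega

/-- With m_p ≤ m_q + 1 and m_q ≥ 1 one has 2 + m_p d ≤ m_q d + d + 2 ≤ 2 m_q d + 2 m_q. -/
theorem representation_size_le {p : NCPoly ℂ n} (h : 1 ≤ p.deg) :
    2 + p.numMonomials * p.deg ≤ 2 * p.reducedPart.numMonomials * p.reducedPart.deg +
      2 * p.reducedPart.numMonomials := by
  have h1 := numMonomials_le p
  have h2 : 1 ≤ p.reducedPart.numMonomials := numMonomials_pos (by rwa [deg_reducedPart])
  rw [deg_reducedPart]
  have h3 := Nat.mul_le_mul_right p.deg h1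
  have h4 := Nat.mul_le_mul_right p.deg h2
  nlinarith

end Monomials

end NCPoly

/-! ### Assembly of the algorithms and their step bounds. -/

namespace Machine

open NCPoly

section Assembly

variable {n : ℕ} {p : NCPoly ℂ n}

/-- This identifies what the encoding program stores with the automaton: a weight zα is α in the
cell of degree 1, and a weight 1 is 1 in the cell of degree 0. -/
theorem coeff_edgeWeight (words : Fin p.numMonomials ≃ p.coeff.support) (i : Fin n) (x y l : ℕ) :
    (edgeWeight (wordAt words) (fun j => Polynomial.X * Polynomial.C (coeffAt words j)) p.deg
      p.numMonomials i x y).coeff l =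
      ∑ j ∈ Finset.range p.numMonomials, ∑ t ∈ Finset.range (wordAt words j).length,
        edgeCell (fun j => (wordAt words j).length)
          (fun j t => ((wordAt words j).map Fin.val).getD t 0) (coeffAt words) p.deg
          (1 + p.numMonomials * p.deg) j t [(i : ℕ), x, y, l] := by
  rw [edgeWeight, Polynomial.finsetSum_coeff]
  refine Finset.sum_congr rfl fun j _ => ?_
  rw [Polynomial.finsetSum_coeff]
  refine Finset.sum_congr rfl fun t ht => ?_
  rw [Finset.mem_range] at ht
  have hX : ∀ c : ℂ, (Polynomial.X * Polynomial.C c).coeff l = if l = 1 then c else 0 := by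
    intro c
    rw [mul_comm, Polynomial.coeff_C_mul, Polynomial.coeff_X]
    simp [eq_comm]
  have hl : ((wordAt words j).map Fin.val).getD t 0 = ((wordAt words j)[t] : ℕ) := by
    rw [List.getD_eq_getElem _ _ (by simpa using ht), List.getElem_map]
  have hi : ((wordAt words j)[t]? = some i) ↔ (i : ℕ) = ((wordAt words j)[t] : ℕ) := by
    rw [List.getElem?_eq_getElem ht, Option.some_inj, Fin.ext_iff, eq_comm]
  simp only [edgeCell, hl, List.cons.injEq, and_true, hi]
  by_cases h1 : (i : ℕ) = ((wordAt words j)[t] : ℕ) ∧ x = srcState p.deg j t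
  · rw [if_pos h1]
    simp only [h1.1, h1.2, true_and]
    by_cases h2 : (wordAt words j).length ≤ t + 1
    · rw [if_pos h2, if_pos h2, Polynomial.coeff_add]
      congr 1
      · by_cases hy : y = 0
        · rw [if_pos hy, hX]
          simp [hy]
        · simp [hy]
      · by_cases hy : y = 1 + p.numMonomials * p.deg
        · rw [if_pos hy, hX]
          simp [hy]
        · simp [hy]
    · rw [if_neg h2, if_neg h2]
      by_cases hy : y = j * p.deg + t + 1
      · rw [if_pos hy, Polynomial.coeff_one]
        simp [hy]
      · simp [hy]
  · rw [if_neg h1, Polynomial.coeff_zero]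
    have : ∀ q : Prop, ¬((i : ℕ) = ((wordAt words j)[t] : ℕ) ∧ x = srcState p.deg j t ∧ q) :=
      fun q h => h1 ⟨h.1, h.2.1⟩
    simp only [this, if_false, add_zero, ite_self]

section MomentTable

variable {A : Type*} [Ring A] [Algebra ℂ A] {τ : A →ₗ[ℂ] ℂ} {s : Fin n → A} {M : ℕ}

/-- Since p = c + q, one has pʲ⁺¹ qᵐ = c pʲ qᵐ + pʲ qᵐ⁺¹. -/
theorem momentTable_eq (t : ℕ → ℂ) (ht : ∀ m ≤ M, t m = τ (p.reducedPart.evalAt s ^ m)) (j m : ℕ)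
    (hjm : m + j ≤ M) : momentTable p.constPart t j m =
      τ (p.evalAt s ^ j * p.reducedPart.evalAt s ^ m) := by
  induction j generalizing m with
  | zero => rw [momentTable, ht m hjm, pow_zero, one_mul]
  | succ j ih =>
    have h : p.evalAt s * p.reducedPart.evalAt s ^ m =
        p.constPart • p.reducedPart.evalAt s ^ m + p.reducedPart.evalAt s ^ (m + 1) := by
      rw [evalAt_eq_add_reducedPart p, add_mul, smul_mul_assoc, one_mul, ← pow_succ']
    rw [momentTable, ih m (by omega), ih (m + 1) (by omega), pow_succ (p.evalAt s), mul_assoc, h,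
      mul_add, mul_smul_comm, map_add, map_smul, smul_eq_mul]

theorem holdsMoments_of_iteration [Star A] (h1 : τ 1 = 1)
    (hs : ∀ i, IsStandardSemicircular τ (s i)) (hf : FreelyIndependent τ s) {N : ℕ} (hN : 2 ≤ N)
    (μ : FreeMonoid (Fin n) →* Matrix (Fin N) (Fin N) ℂ[X])
    (hμ : Represents hN μ p.reducedPart.zMul.pseudoInverse) {st : Store ℂ}
    (h4 : ∀ m ≤ M, st.num 4 [m] = truncCoeff m
      (matrixIterate (truncMatrices M μ) (p.deg * M) (firstIdx hN) (lastIdx hN)))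
    (h5 : st.num 5 [] = momentTable p.constPart (fun m => if m = 0 then 1 else truncCoeff m
      (matrixIterate (truncMatrices M μ) (p.deg * M) (firstIdx hN) (lastIdx hN))) M 0) :
    HoldsMoments τ s p M st := by
  refine ⟨fun m hm hmM => ?_, ?_⟩
  · rw [h4 m hmM, moment_eq_truncCoeff h1 hs hf p hN μ hμ hm hmM]
  · rw [h5, momentTable_eq (s := s) (τ := τ) (M := M) _ _ M 0 (by omega), pow_zero, mul_one]
    intro m hm
    split_ifs with h0
    · rw [h0, pow_zero, h1]
    · rw [moment_eq_truncCoeff h1 hs hf p hN μ hμ (by omega) hm]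

end MomentTable

theorem holdsData_matrixInput {N M : ℕ} (μ : Fin n → Matrix (Fin N) (Fin N) (TruncPoly M)) :
    HoldsData p.deg μ (matrixInput p M μ) where
  vars := rfl
  order := rfl
  size := rfl
  degree := rfl
  matrices i j k _ hl := dif_pos ⟨i.2, j.2, k.2, hl⟩

/-- The whole algorithm, started from the list of monomials. -/
def encodeAndIterate : Program := .seq encode iterationAndMoments

/-- The outputs are described by matrix coefficients alone, without a trace, so that one run and one
`μ` serve all semicircular systems. -/
theorem runs_encodeAndIterate {M : ℕ} (hM : 1 ≤ M) (words : Fin p.numMonomials ≃ p.coeff.support) :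
    ∃ (hN : 2 ≤ 2 + p.numMonomials * p.deg)
      (μ : FreeMonoid (Fin n) →* Matrix (Fin (2 + p.numMonomials * p.deg))
        (Fin (2 + p.numMonomials * p.deg)) ℂ[X]),
      Represents hN μ p.reducedPart.zMul.pseudoInverse ∧
      Runs encodeAndIterate (polyInput p M words)
        (500 * ((p.numMonomials + 1) * (p.deg + 1)) + 400000 * ((p.deg + 1) * ((n + 1) *
          ((2 + p.numMonomials * p.deg) ^ 3 * (M + 1) ^ 3)))) fun st =>
        HoldsEncoding p M (truncMatrices M μ) st ∧
        HoldsMatrix (matrixIterate (truncMatrices M μ) (p.deg * M)) st ∧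
        (∀ m ≤ M, st.num 4 [m] = truncCoeff m
          (matrixIterate (truncMatrices M μ) (p.deg * M) (firstIdx hN) (lastIdx hN))) ∧
        st.num 5 [] = momentTable p.constPart (fun m => if m = 0 then 1 else truncCoeff m
          (matrixIterate (truncMatrices M μ) (p.deg * M) (firstIdx hN) (lastIdx hN))) M 0 := by
  classical
  have hN : 2 ≤ 2 + p.numMonomials * p.deg := Nat.le_add_right _ _
  set μ := edgeHom (wordAt words) (fun j => Polynomial.X * Polynomial.C (coeffAt words j)) p.deg
    p.numMonomials with hμ
  refine ⟨hN, μ, represents_edgeHom _ ?_ (zMul_reducedPart_eq_sum words) (length_wordAt_le words) hN,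
    ?_⟩
  · have h := coeff_zMul_pow p.reducedPart 1 1
    rw [pow_one, pow_one, pow_one, coeff_reducedPart, if_pos rfl, map_zero, mul_zero] at h
    exact h
  refine Runs.seq (runs_encode (m := p.numMonomials) (d := p.deg)
    (len := fun j => (wordAt words j).length)
    (letter := fun j t => ((wordAt words j).map Fin.val).getD t 0) (α := coeffAt words) rfl rfl rfl
    rfl rfl ?_ ?_ ?_ ?_ (sup_range_numMonomials words)) fun s1 hA1 h1 => ?_
  · funext i
    rfl
  · intro j hj
    refine (dif_pos hj).trans ?_
    rw [wordAt, dif_pos hj]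
    rfl
  · intro j hj x _
    refine (dif_pos hj).trans ?_
    rw [wordAt, dif_pos hj]
  · intro j hj
    refine (dif_pos hj).trans ?_
    rw [coeffAt, dif_pos hj]
  · obtain ⟨h6, h5, hc, h2⟩ := h1
    have hdata : HoldsData p.deg (truncMatrices M μ) s1 := by
      refine ⟨?_, ?_, h5, h6, fun i j k l hl => ?_⟩
      · exact congrFun (hA1.nat 0 (by decide)) []
      · exact congrFun (hA1.nat 1 (by decide)) []
      · rw [h2, ← coeff_edgeWeight, truncMatrices, Matrix.map_apply, truncCoeff_mk hl, hμ]
        simp [edgeHom]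
    have hc' : s1.num 1 [] = p.constPart := hc.trans (sum_coeffAt_eq_constPart words)
    refine (runs_iterationAndMoments hN hM hdata).mono le_rfl fun s2 hA2 h => ⟨⟨?_, ?_, ?_⟩, h.1,
      h.2.1, ?_⟩
    · rw [hA2.nat 5 (by decide), h5]
    · rw [hA2.num 1 (by decide), hc']
    · rw [hA2.num 2 (by decide)]
      exact hdata.matrices
    · rw [h.2.2, hc']

theorem succ_le_two_mul {k : ℕ} (h : 1 ≤ k) : k + 1 ≤ 2 * k := by omega

theorem iteration_cost_le {d n N M : ℕ} (hd : 1 ≤ d) (hn : 1 ≤ n) (hM : 1 ≤ M) :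
    400000 * ((d + 1) * ((n + 1) * (N ^ 3 * (M + 1) ^ 3))) ≤
      12800000 * (d * n * N ^ 3 * M ^ 3) := by
  calc _ ≤ 400000 * ((2 * d) * ((2 * n) * (N ^ 3 * (2 * M) ^ 3))) := by
        gcongr <;> exact succ_le_two_mul ‹_›
    _ = _ := by ring

/-- Here 2 + md ≤ 3md turns N³ into 27 m³ d³, and 27 · 12800000 = 345600000. The encoding costs at
most 2000 times the same monomial. -/
theorem encodeAndIterate_cost_le {d m n M : ℕ} (hd : 1 ≤ d) (hm : 1 ≤ m) (hn : 1 ≤ n)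
    (hM : 1 ≤ M) : 500 * ((m + 1) * (d + 1)) +
      400000 * ((d + 1) * ((n + 1) * ((2 + m * d) ^ 3 * (M + 1) ^ 3))) ≤
      400000000 * (d ^ 4 * m ^ 3 * n * M ^ 3) := by
  have h1 : 500 * ((m + 1) * (d + 1)) ≤ 2000 * (d ^ 4 * m ^ 3 * n * M ^ 3) :=
    calc _ ≤ 500 * ((2 * m) * (2 * d)) := by gcongr <;> exact succ_le_two_mul ‹_›
      _ = 2000 * (d * m * 1 * 1) := by ring
      _ ≤ _ := by
        gcongr
        · exact Nat.le_self_pow (by omega) _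
        · exact Nat.le_self_pow (by omega) _
        · exact Nat.pow_pos hM
  have hmd : 1 ≤ m * d := Nat.mul_pos hm hd
  have h2 : 400000 * ((d + 1) * ((n + 1) * ((2 + m * d) ^ 3 * (M + 1) ^ 3))) ≤
      345600000 * (d ^ 4 * m ^ 3 * n * M ^ 3) :=
    calc _ ≤ 12800000 * (d * n * (2 + m * d) ^ 3 * M ^ 3) := iteration_cost_le hd hn hM
      _ ≤ 12800000 * (d * n * (3 * (m * d)) ^ 3 * M ^ 3) := by gcongr; omega
      _ = _ := by ring
  omega

end Assembly

end Machine

theorem mainTheorem1 :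
    -- correctness of the matrix iteration and of the binomial step
    (∀ (A : Type u) [CStarAlgebra A] [PartialOrder A] [StarOrderedRing A] [WStarAlgebra A]
        (τ : A →ₗ[ℂ] ℂ) (n : ℕ) (s : Fin n → A), IsFreeSemicircularSystem τ s →
        ∀ (p : NCPoly ℂ n) (M : ℕ), 1 ≤ M →
          (∀ (N : ℕ) (hN : 2 ≤ N) (μ : FreeMonoid (Fin n) →* Matrix (Fin N) (Fin N) (Polynomial ℂ)),
            Represents hN μ p.reducedPart.zMul.pseudoInverse →
            ∀ m : ℕ, 1 ≤ m → m ≤ M →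
              τ (p.reducedPart.evalAt s ^ m) =
                truncCoeff m (matrixIterate (truncMatrices M μ) (p.deg * M)
                  (firstIdx hN) (lastIdx hN))) ∧
          τ (p.evalAt s ^ M) =
            ∑ k ∈ Finset.range (M + 1), (M.choose k : ℂ) * p.constPart ^ k *
              τ (p.reducedPart.evalAt s ^ (M - k))) ∧
    -- the iteration and the binomial step, started from any given representation
    (∃ (prog : Machine.Program) (C : ℕ),
      ∀ (n : ℕ) (p : NCPoly ℂ n) (M : ℕ), 1 ≤ M →
        ∀ (N : ℕ) (hN : 2 ≤ N) (μ : FreeMonoid (Fin n) →* Matrix (Fin N) (Fin N) (Polynomial ℂ)),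
          Represents hN μ p.reducedPart.zMul.pseudoInverse →
          HoldsMatrix (matrixIterate (truncMatrices M μ) (p.deg * M))
            (prog.run (matrixInput p M (truncMatrices M μ))).1 ∧
          (∀ (A : Type u) [CStarAlgebra A] [PartialOrder A] [StarOrderedRing A] [WStarAlgebra A]
            (τ : A →ₗ[ℂ] ℂ) (s : Fin n → A), IsFreeSemicircularSystem τ s →
            HoldsMoments τ s p M (prog.run (matrixInput p M (truncMatrices M μ))).1) ∧
          (1 ≤ p.deg → (prog.run (matrixInput p M (truncMatrices M μ))).2 ≤
            C * (p.deg * n * N ^ 3 * M ^ 3))) ∧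
    -- the whole algorithm, started from the polynomial
    (∃ (prog : Machine.Program) (C : ℕ),
      ∀ (n : ℕ) (p : NCPoly ℂ n) (M : ℕ), 1 ≤ M →
        ∀ words : Fin p.numMonomials ≃ p.coeff.support,
          (∃ (N : ℕ) (hN : 2 ≤ N) (μ : FreeMonoid (Fin n) →* Matrix (Fin N) (Fin N) (Polynomial ℂ)),
            Represents hN μ p.reducedPart.zMul.pseudoInverse ∧
            (1 ≤ p.deg → N ≤ 2 * p.reducedPart.numMonomials * p.reducedPart.deg +
              2 * p.reducedPart.numMonomials) ∧
            HoldsEncoding p M (truncMatrices M μ) (prog.run (polyInput p M words)).1 ∧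
            HoldsMatrix (matrixIterate (truncMatrices M μ) (p.deg * M))
              (prog.run (polyInput p M words)).1) ∧
          (∀ (A : Type u) [CStarAlgebra A] [PartialOrder A] [StarOrderedRing A] [WStarAlgebra A]
            (τ : A →ₗ[ℂ] ℂ) (s : Fin n → A), IsFreeSemicircularSystem τ s →
            HoldsMoments τ s p M (prog.run (polyInput p M words)).1) ∧
          (1 ≤ p.deg → (prog.run (polyInput p M words)).2 ≤
            C * (p.deg ^ 4 * p.numMonomials ^ 3 * n * M ^ 3))) := by
  refine ⟨?_, ⟨Machine.iterationAndMoments, 12800000, ?_⟩,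
    ⟨Machine.encodeAndIterate, 400000000, ?_⟩⟩
  · intro A _ _ _ _ τ n s hs p M _
    exact ⟨fun N hN μ hμ m hm hmM =>
      moment_eq_truncCoeff hs.state.map_one hs.semicircular hs.free p hN μ hμ hm hmM,
      moment_eq_sum_choose p M⟩
  · intro n p M hM N hN μ hμ
    obtain ⟨hcost, hP, h4, h5⟩ := Machine.runs_iterationAndMoments hN hM
      (Machine.holdsData_matrixInput (p := p) (truncMatrices M μ))
    refine ⟨hP, ?_, fun hd => hcost.trans (Machine.iteration_cost_le hd (NCPoly.vars_pos hd) hM)⟩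
    intro A _ _ _ _ τ s hs
    exact Machine.holdsMoments_of_iteration hs.state.map_one hs.semicircular hs.free hN μ hμ h4 h5
  · intro n p M hM words
    obtain ⟨hN, μ, hμ, hcost, hE, hP, h4, h5⟩ := Machine.runs_encodeAndIterate hM words
    refine ⟨⟨_, hN, μ, hμ, NCPoly.representation_size_le, hE, hP⟩, ?_, fun hd => hcost.trans
      (Machine.encodeAndIterate_cost_le hd (NCPoly.numMonomials_pos hd) (NCPoly.vars_pos hd) hM)⟩
    intro A _ _ _ _ τ s hs
    exact Machine.holdsMoments_of_iteration hs.state.map_one hs.semicircular hs.free hN μ hμ h4 h5
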